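/- Let $N\ge 3$ be an integer, let $\frac{2}{N-2}<\alpha<\frac{4}{N-2}$, and set $\beta=\frac2\alpha\bigl(N-2-\frac2\alpha\bigr)>0$. Let $u\in C^2(0,\infty)$, $u\not\equiv 0$, be a real-valued solution of $$u''+\frac{N-1}{r}u'+|u|^\alpha u=0\quad\text{on }(0,\infty). \tag{1}$$ Call $u$ *regular* if it extends to a function in $C^2([0,\infty))$ with $u'(0)=0$; *singular* if it has no finite limit as $r\to0$; *sign-changing* if it takes both positive and negative values on $(0,\infty)$. Say that $u$ *oscillates indefinitely* as $r\to\infty$ if it takes both positive and negative values at arbitrarily large $r$. Then the following properties hold. (i) There is a constant $C$ (depending on $u$) such that $|u(r)|\le C\,r^{-(N-2-\frac2\alpha)}$ for all $r>1$. In addition, either $u(r)$ has a finite limit as $r\to0$, and then $u'(r)\to0$ as $r\to 0$; or else, for some sign $\sigma\in\{1,-1\}$, $r^{\frac2\alpha}u(r)\to\sigma\beta^{\frac1\alpha}$ and $r^{\frac2\alpha+1}u'(r)\to-\sigma\frac2\alpha\beta^{\frac1\alpha}$ as $r\to0$. (ii) $u$ satisfies one of the following properties. (a) $u$ is a regular solution.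 In this case, $u$ oscillates indefinitely as $r\to\infty$. (b) $u$ is a constant-sign singular solution, namely either $u=\pm\beta^{\frac1\alpha}r^{-\frac2\alpha}$, or else there is $\lambda>0$ such that $u=\pm u_\lambda$, where $u_\lambda$ is the unique positive $C^2$ solution of (1) on $(0,\infty)$ with $r^{\frac2\alpha}u_\lambda(r)\to\beta^{\frac1\alpha}$ as $r\to0$ and $r^{N-2}u_\lambda(r)\to\lambda$ as $r\to\infty$ (the existence and the uniqueness of $u_\lambda$ for this $\lambda$ being part of the assertion). (c) $u$ is a singular, sign-changing solution. In this case, $r^{\frac2\alpha}u(r)$ converges to $\beta^{\frac1\alpha}$ or to $-\beta^{\frac1\alpha}$ as $r\to0$, and $u$ oscillates indefinitely as $r\to\infty$. (iii) $u$ satisfies (c) if and only if there exists $r_0>0$ such that $$\frac{r_0^2}{2}|u'(r_0)|^2+\frac2\alpha r_0u(r_0)u'(r_0)+\frac1{\alpha+2}r_0^2|u(r_0)|^{\alpha+2}+\frac{4-(N-2)\alpha}{\alpha^2}|u(r_0)|^2=0.$$ (iv) Let $U\in C^2(\mathbb R^N\setminus\{0\})$ be defined by $U(x)=u(|x|)$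 for $x\ne0$. Then $U\in L^{\alpha+1}_{\mathrm{loc}}(\mathbb R^N)$ and $U$ is a solution of $-\Delta U=|U|^\alpha U$ in $\mathcal D'(\mathbb R^N)$, that is, $-\int_{\mathbb R^N}U\,\Delta\varphi=\int_{\mathbb R^N}|U|^\alpha U\varphi$ for every $\varphi\in C^\infty_c(\mathbb R^N)$. -/

import Mathlib

open Set Filter Topology MeasureTheory

namespace RadialStationary

/-- The constant `β = (2/α) (N - 2 - 2/α)`. -/
noncomputable def beta (N : ℕ) (α : ℝ) : ℝ :=
  2 / α * ((N : ℝ) - 2 - 2 / α)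

/-- `u` is a `C²` solution of `u'' + ((N-1)/r) u' + |u|^α u = 0` on `(0,∞)`.
Only the values of `u` on `(0,∞)` matter. -/
def IsSolution (N : ℕ) (α : ℝ) (u : ℝ → ℝ) : Prop :=
  ContDiffOn ℝ 2 u (Ioi 0) ∧
    ∀ r : ℝ, 0 < r →
      deriv (deriv u) r + ((N : ℝ) - 1) / r * deriv u r + |u r| ^ α * u r = 0

/-- `u` oscillates indefinitely as `r → ∞`: it takes positive values, and also negative values,
at arbitrarily large `r`. -/
def OscillatesAtInfinity (u : ℝ → ℝ) : Prop :=
  (∃ᶠ r in atTop, 0 < u r) ∧ (∃ᶠ r in atTop, u r < 0)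

/-- `u` extends to a `C²` function on `[0,∞)` with derivative `0` at the origin. -/
def IsRegularSolution (u : ℝ → ℝ) : Prop :=
  ∃ w : ℝ → ℝ, ContDiffOn ℝ 2 w (Ici 0) ∧ EqOn u w (Ioi 0) ∧ derivWithin w (Ici 0) 0 = 0

/-- `u` is singular at the origin: it has no finite limit as `r → 0⁺`. -/
def IsSingular (u : ℝ → ℝ) : Prop :=
  ¬ ∃ l : ℝ, Tendsto u (𝓝[>] 0) (𝓝 l)

/-- `u` takes both a positive and a negative value on `(0,∞)`. -/
def IsSignChanging (u : ℝ → ℝ) : Prop :=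
  (∃ r : ℝ, 0 < r ∧ 0 < u r) ∧ (∃ r : ℝ, 0 < r ∧ u r < 0)

/-- `w` is a positive solution with `r^(2/α) w → β^(1/α)` as `r → 0⁺` and
`r^(N-2) w → lam` as `r → ∞`. -/
structure HasULambdaAsymptotics (N : ℕ) (α lam : ℝ) (w : ℝ → ℝ) : Prop where
  isSolution : IsSolution N α w
  pos : ∀ r : ℝ, 0 < r → 0 < w r
  at_zero : Tendsto (fun r : ℝ => r ^ (2 / α) * w r) (𝓝[>] 0) (𝓝 (beta N α ^ (1 / α)))
  at_top : Tendsto (fun r : ℝ => r ^ ((N : ℝ) - 2) * w r) atTop (𝓝 lam)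

/-- `w` is, on `(0,∞)`, the member `u_lam` of the one-parameter family of positive singular
solutions: it has the defining asymptotics, and it is the only solution that has them. -/
def IsULambda (N : ℕ) (α lam : ℝ) (w : ℝ → ℝ) : Prop :=
  HasULambdaAsymptotics N α lam w ∧
    ∀ w' : ℝ → ℝ, HasULambdaAsymptotics N α lam w' → EqOn w' w (Ioi 0)

/-- `u` is a constant-sign singular solution: `u = ± β^(1/α) r^(-2/α)`, or `u = ± u_lam` for
some `lam > 0`. -/
def IsConstantSignSingular (N : ℕ) (α : ℝ) (u : ℝ → ℝ) : Prop :=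
  (∀ r : ℝ, 0 < r → u r = beta N α ^ (1 / α) * r ^ (-(2 / α))) ∨
  (∀ r : ℝ, 0 < r → u r = -(beta N α ^ (1 / α) * r ^ (-(2 / α)))) ∨
  (∃ lam : ℝ, 0 < lam ∧ ∃ w : ℝ → ℝ, IsULambda N α lam w ∧
    ((∀ r : ℝ, 0 < r → u r = w r) ∨ (∀ r : ℝ, 0 < r → u r = -w r)))

/-- The energy
`(r²/2) u'² + (2/α) r u u' + (1/(α+2)) r² |u|^(α+2) + ((4 - (N-2) α)/α²) u²` at `r`. -/
noncomputable def energy (N : ℕ) (α : ℝ) (u : ℝ → ℝ) (r : ℝ) : ℝ :=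
  r ^ 2 / 2 * |deriv u r| ^ 2 + 2 / α * r * u r * deriv u r
    + 1 / (α + 2) * r ^ 2 * |u r| ^ (α + 2)
    + (4 - ((N : ℝ) - 2) * α) / α ^ 2 * |u r| ^ 2

/-- The radial function `U(x) = u(|x|)` on `ℝ^N`; its value at the origin plays no role. -/
noncomputable def radial (N : ℕ) (u : ℝ → ℝ) : EuclideanSpace ℝ (Fin N) → ℝ :=
  fun x => u ‖x‖

/-- `-ΔU = |U|^α U` in the sense of distributions on `ℝ^N`: both `U` and `|U|^α U` are locally
integrable, and the equation holds against every smooth compactly supported test function. -/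
def IsDistributionalSolution (N : ℕ) (α : ℝ) (U : EuclideanSpace ℝ (Fin N) → ℝ) : Prop :=
  LocallyIntegrable U volume ∧
  LocallyIntegrable (fun x => |U x| ^ α * U x) volume ∧
  ∀ φ : EuclideanSpace ℝ (Fin N) → ℝ, ContDiff ℝ (⊤ : ℕ∞) φ → HasCompactSupport φ →
    -(∫ x, U x * Laplacian.laplacian φ x) = ∫ x, |U x| ^ α * U x * φ x

end RadialStationary

open RadialStationary

namespace RadialStationary

/-! ### Monotonicity helpers -/

/-! Put `p = 2/α`, `q = N - 2 - 2/α` and `v(t) = e^{pt} u(e^t)`. Equation (1) becomes autonomous,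
`v'' = (p - q) v' + p q v - |v|^α v`, with `p q = β`, and the bounds on `α` say exactly that `0 < q
< p`. The energy `E = v'²/2 - p q v²/2 + |v|^{α+2}/(α+2)` is coercive and satisfies `E' = (p - q)
v'² ≥ 0`. Up to the factor `e^{2pt}` it is the quantity in (iii).

Backward in time `E` is bounded, so the trajectory is bounded and converges to an equilibrium, `0`
or `±β^{1/α}` (`IsTrajectory.exists_tendsto_of_bounded`). The origin is a saddle with rates `p` and
`-q`. If `v → 0` at `-∞`, then `e^{-pt} v = u` has a limit, `u` is regular, and `E > 0` at all
times. Otherwise `u` is singular and `E` starts out negative.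

Once `E > 0`, `v` oscillates: an eventually positive `v` would be bounded, by a Riccati argument for
`v'/v`, hence would converge to an equilibrium, where the energy is at most `0`. If `E` vanishes
somewhere, it is positive afterwards and `u` is of type (c). If `E` stays negative, `v` has no zero
and converges at `+∞`. Either the limit is a nonzero equilibrium, at the same energy level as the
starting one, and `v` is constant; or `v → 0` and `e^{qt} v` has a nonzero limit, which determines
the trajectory (`IsTrajectory.exists_tendsto_exp_mul_sub`): this is `±u_λ`.

For (iv), `|u| ≤ C r^{-2/α}` near `0` and `2/α + 2 < N`. Both `|U|^{α+1}` and `U Δ(φ η)`, with `η` a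
dilated cutoff, are then dominated near the origin by the integrable function `|x|^{-(2/α+2)}`, so
the origin is removable. -/

lemma monotoneOn_of_hasDerivAt {D : Set ℝ} (hD : Convex ℝ D) {h h' : ℝ → ℝ}
    (hd : ∀ t ∈ D, HasDerivAt h (h' t) t) (hn : ∀ t ∈ D, 0 ≤ h' t) : MonotoneOn h D := by
  refine monotoneOn_of_deriv_nonneg hD (fun t ht => (hd t ht).continuousAt.continuousWithinAt)
    (fun t ht => (hd t (interior_subset ht)).differentiableAt.differentiableWithinAt) ?_
  intro t ht
  rw [(hd t (interior_subset ht)).deriv]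
  exact hn t (interior_subset ht)

lemma antitoneOn_of_hasDerivAt {D : Set ℝ} (hD : Convex ℝ D) {h h' : ℝ → ℝ}
    (hd : ∀ t ∈ D, HasDerivAt h (h' t) t) (hn : ∀ t ∈ D, h' t ≤ 0) : AntitoneOn h D := by
  have := monotoneOn_of_hasDerivAt hD (h := fun t => -h t) (h' := fun t => -h' t)
    (fun t ht => (hd t ht).neg) (fun t ht => by have := hn t ht; linarith)
  intro s hs t ht hst
  have := this hs ht hst
  simp only at this
  linarith

/-! ### The nonlinearity -/

lemma hasDerivAt_abs_rpow_mul_self {α : ℝ} (hα : 0 < α) (x : ℝ) :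
    HasDerivAt (fun y : ℝ => |y| ^ α * y) ((α + 1) * |x| ^ α) x := by
  rcases lt_trichotomy x 0 with hx | rfl | hx
  · have h1 : HasDerivAt (fun y : ℝ => (-y) ^ α * y) ((α + 1) * |x| ^ α) x := by
      have := ((hasDerivAt_neg x).rpow_const (p := α) (Or.inl (by simpa using hx.ne))).mul
        (hasDerivAt_id x)
      refine this.congr_deriv ?_
      rw [abs_of_neg hx]
      have h2 : (-x) ^ α = (-x) ^ (α - 1) * (-x) := by
        rw [← Real.rpow_add_one (by linarith)]; ring_nf
      simp only [id]
      rw [h2]; ring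
    refine h1.congr_of_eventuallyEq ?_
    filter_upwards [Iio_mem_nhds hx] with y hy
    rw [abs_of_neg hy]
  · rw [hasDerivAt_iff_tendsto_slope_zero]
    have h1 : Tendsto (fun t : ℝ => |t| ^ α) (𝓝[≠] 0) (𝓝 (|(0 : ℝ)| ^ α)) :=
      ((continuous_abs.rpow_const (fun _ => Or.inr hα.le)).tendsto 0).mono_left nhdsWithin_le_nhds
    rw [abs_zero, Real.zero_rpow hα.ne'] at h1
    simp only [abs_zero, Real.zero_rpow hα.ne', mul_zero, zero_add, sub_zero, smul_eq_mul]
    refine h1.congr' ?_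
    filter_upwards [self_mem_nhdsWithin] with t ht
    have ht : t ≠ 0 := ht
    field_simp
  · have h1 : HasDerivAt (fun y : ℝ => y ^ α * y) ((α + 1) * |x| ^ α) x := by
      have := ((hasDerivAt_id x).rpow_const (p := α) (Or.inl hx.ne')).mul (hasDerivAt_id x)
      refine this.congr_deriv ?_
      rw [abs_of_pos hx]
      have h2 : x ^ α = x ^ (α - 1) * x := by
        rw [← Real.rpow_add_one hx.ne']; ring_nf
      simp only [id]
      rw [h2]; ring
    refine h1.congr_of_eventuallyEq ?_
    filter_upwards [Ioi_mem_nhds hx] with y hy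
    rw [abs_of_pos hy]

lemma continuous_abs_rpow_mul_self {α : ℝ} (hα : 0 < α) :
    Continuous (fun y : ℝ => |y| ^ α * y) :=
  (continuous_abs.rpow_const (fun _ => Or.inr hα.le)).mul continuous_id

lemma abs_nonlinearity_sub_le {α M x y : ℝ} (hα : 0 < α) (hx : |x| ≤ M) (hy : |y| ≤ M) :
    |(|x| ^ α * x) - |y| ^ α * y| ≤ (α + 1) * M ^ α * |x - y| := by
  have := (convex_Icc (-M) M).norm_image_sub_le_of_norm_hasDerivWithin_le
    (f := fun y : ℝ => |y| ^ α * y) (f' := fun x => (α + 1) * |x| ^ α) (C := (α + 1) * M ^ α)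
    (x := y) (y := x)
    (fun z _ => (hasDerivAt_abs_rpow_mul_self hα z).hasDerivWithinAt) ?_
    (abs_le.1 hy) (abs_le.1 hx)
  · simpa only [Real.norm_eq_abs] using this
  · intro z hz
    rw [Real.norm_eq_abs, abs_of_nonneg (by positivity)]
    have : |z| ≤ M := abs_le.2 hz
    gcongr

/-! ### The autonomous equation -/

/-- `v` and its derivative `v'` solve `v'' = (p - q) v' + p q v - |v|^α v` on `ℝ`. -/
structure IsTrajectory (p q α : ℝ) (v v' : ℝ → ℝ) : Prop where
  left : ∀ t, HasDerivAt v (v' t) t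
  right : ∀ t, HasDerivAt v' ((p - q) * v' t + p * q * v t - |v t| ^ α * v t) t

namespace IsTrajectory

variable {p q α : ℝ} {v v' : ℝ → ℝ}

/-- Time reversal exchanges `p` and `q`, so results at `+∞` proved without ordering `p` and `q` also
apply at `-∞`. -/
lemma reverse (h : IsTrajectory p q α v v') :
    IsTrajectory q p α (fun t => v (-t)) (fun t => -v' (-t)) where
  left t := by
    have := (h.left (-t)).comp t (hasDerivAt_neg t)
    simpa [Function.comp_def] using this
  right t := by
    have := ((h.right (-t)).comp t (hasDerivAt_neg t)).neg
    refine this.congr_deriv ?_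
    ring

lemma neg (h : IsTrajectory p q α v v') :
    IsTrajectory p q α (fun t => -v t) (fun t => -v' t) where
  left t := (h.left t).neg
  right t := by
    refine (h.right t).neg.congr_deriv ?_
    rw [abs_neg]; ring

lemma continuous_left (h : IsTrajectory p q α v v') : Continuous v :=
  continuous_iff_continuousAt.2 fun t => (h.left t).continuousAt

end IsTrajectory

/-- The energy of the autonomous equation. -/
noncomputable def trajEnergy (p q α : ℝ) (v v' : ℝ → ℝ) (t : ℝ) : ℝ :=
  v' t ^ 2 / 2 - p * q * v t ^ 2 / 2 + |v t| ^ (α + 2) / (α + 2)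

/-- Multiplying the equation by `v'` turns every term but the first-order one into an exact
derivative. -/
lemma IsTrajectory.hasDerivAt_energy {p q α : ℝ} {v v' : ℝ → ℝ} (hα : 0 < α)
    (h : IsTrajectory p q α v v') (t : ℝ) :
    HasDerivAt (trajEnergy p q α v v') ((p - q) * v' t ^ 2) t := by
  have h1 := ((h.right t).pow 2).div_const 2
  have h2 := (((h.left t).pow 2).const_mul (p * q)).div_const 2
  have h3 := ((hasDerivAt_abs_rpow (v t) (p := α + 2) (by linarith)).comp t
    (h.left t)).div_const (α + 2)
  refine ((h1.sub h2).add h3).congr_deriv ?_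
  rw [show α + 2 - 2 = α by ring]
  have : α + 2 ≠ 0 := by linarith
  field_simp
  push_cast
  ring

/-- Backward and forward uniqueness for a second order differential inequality. -/
lemma eq_zero_of_second_order {K : ℝ} {a b t₀ : ℝ} (ht₀ : t₀ ∈ Icc a b) {d d' d'' : ℝ → ℝ}
    (hd : ∀ t, HasDerivAt d (d' t) t) (hd' : ∀ t, HasDerivAt d' (d'' t) t)
    (hK : ∀ t ∈ Icc a b, |d'' t| ≤ K * (|d t| + |d' t|))
    (h0 : d t₀ = 0) (h0' : d' t₀ = 0) : ∀ t ∈ Icc a b, d t = 0 ∧ d' t = 0 := by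
  -- The constant comes from `2|d||d'| ≤ d² + d'²`, applied to the first product and to the mixed
  -- term of `2|K||d'|(|d| + |d'|)`.
  have hK' : ∀ t ∈ Icc a b, |2 * d t * d' t + 2 * d' t * d'' t|
      ≤ (1 + 3 * |K|) * (d t ^ 2 + d' t ^ 2) := by
    intro t ht
    have h1 := hK t ht
    have h2 : |d'' t| ≤ |K| * (|d t| + |d' t|) :=
      h1.trans (mul_le_mul_of_nonneg_right (le_abs_self K) (by positivity))
    rw [← sq_abs (d t), ← sq_abs (d' t)]
    have h3 : |2 * d t * d' t + 2 * d' t * d'' t|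
        ≤ 2 * |d t| * |d' t| + 2 * |d' t| * |d'' t| := by
      refine (abs_add_le _ _).trans_eq ?_
      simp [abs_mul]
    have h4 : 2 * |d' t| * |d'' t| ≤ 2 * |d' t| * (|K| * (|d t| + |d' t|)) := by gcongr
    have h5 : 0 ≤ |K| * (|d t| - |d' t|) ^ 2 := by positivity
    have h6 : 0 ≤ |K| * |d t| ^ 2 := by positivity
    nlinarith [sq_nonneg (|d t| - |d' t|)]
  set L := 1 + 3 * |K|
  -- Gronwall in both directions: the weight with `s = -L` is used to the right of `t₀`, the one
  -- with `s = L` to the left.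
  have hD : ∀ s : ℝ, ∀ t, HasDerivAt (fun t => Real.exp (s * t) * (d t ^ 2 + d' t ^ 2))
      (Real.exp (s * t) * (s * (d t ^ 2 + d' t ^ 2) + (2 * d t * d' t + 2 * d' t * d'' t))) t := by
    intro s t
    have h1 := ((hasDerivAt_id t).const_mul s).exp
    refine (h1.mul (((hd t).pow 2).add ((hd' t).pow 2))).congr_deriv ?_
    simp; ring
  have key : ∀ t ∈ Icc a b, d t ^ 2 + d' t ^ 2 ≤ 0 := by
    intro t ht
    rcases le_total t₀ t with hle | hle
    · have := antitoneOn_of_hasDerivAt (convex_Icc a b) (fun t _ => hD (-L) t) (by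
        intro s hs
        have := abs_le.1 (hK' s hs)
        exact mul_nonpos_of_nonneg_of_nonpos (Real.exp_pos _).le (by linarith [this.2]))
      have := this ht₀ ht hle
      simp only [h0, h0'] at this
      by_contra hc
      push Not at hc
      have := mul_pos (Real.exp_pos (-L * t)) hc
      norm_num at *
      linarith
    · have := monotoneOn_of_hasDerivAt (convex_Icc a b) (fun t _ => hD L t) (by
        intro s hs
        have := abs_le.1 (hK' s hs)
        exact mul_nonneg (Real.exp_pos _).le (by linarith [this.1]))
      have := this ht ht₀ hle
      simp only [h0, h0'] at this
      by_contra hc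
      push Not at hc
      have := mul_pos (Real.exp_pos (L * t)) hc
      norm_num at *
      linarith
  intro t ht
  have := key t ht
  constructor
  · nlinarith [sq_nonneg (d t), sq_nonneg (d' t)]
  · nlinarith [sq_nonneg (d t), sq_nonneg (d' t)]

lemma exists_abs_le_on_Icc {v : ℝ → ℝ} (hv : Continuous v) (a b : ℝ) :
    ∃ M, 0 ≤ M ∧ ∀ t ∈ Icc a b, |v t| ≤ M := by
  obtain ⟨M, hM⟩ := (isCompact_Icc (a := a) (b := b)).exists_bound_of_continuousOn hv.continuousOn
  exact ⟨|M|, abs_nonneg _, fun t ht => (hM t ht).trans (le_abs_self M)⟩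

lemma IsTrajectory.eq_of_eq_at {p q α : ℝ} (hα : 0 < α) {v v' w w' : ℝ → ℝ}
    (hv : IsTrajectory p q α v v') (hw : IsTrajectory p q α w w') {t₀ : ℝ}
    (h : v t₀ = w t₀) (h' : v' t₀ = w' t₀) (t : ℝ) : v t = w t := by
  set a := min t₀ t
  set b := max t₀ t
  obtain ⟨M₁, hM₁, h1⟩ := exists_abs_le_on_Icc hv.continuous_left a b
  obtain ⟨M₂, hM₂, h2⟩ := exists_abs_le_on_Icc hw.continuous_left a b
  set M := max M₁ M₂
  have key := eq_zero_of_second_order (a := a) (b := b) (t₀ := t₀)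
    (K := |p - q| + |p * q| + (α + 1) * M ^ α)
    ⟨min_le_left _ _, le_max_left _ _⟩ (d := fun t => v t - w t) (d' := fun t => v' t - w' t)
    (fun s => (hv.left s).sub (hw.left s)) (fun s => (hv.right s).sub (hw.right s)) ?_
    (by simp [h]) (by simp [h']) t ⟨min_le_right _ _, le_max_right _ _⟩
  · linarith [key.1]
  · intro s hs
    have hl := abs_nonlinearity_sub_le hα ((h1 s hs).trans (le_max_left M₁ M₂))
      ((h2 s hs).trans (le_max_right M₁ M₂))
    have hM : 0 ≤ M ^ α := Real.rpow_nonneg (hM₁.trans (le_max_left _ _)) _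
    have e : (p - q) * v' s + p * q * v s - |v s| ^ α * v s
        - ((p - q) * w' s + p * q * w s - |w s| ^ α * w s)
        = (p - q) * (v' s - w' s) + p * q * (v s - w s)
          - (|v s| ^ α * v s - |w s| ^ α * w s) := by ring
    rw [e]
    have h3 := abs_sub ((p - q) * (v' s - w' s) + p * q * (v s - w s))
      (|v s| ^ α * v s - |w s| ^ α * w s)
    have h4 := abs_add_le ((p - q) * (v' s - w' s)) (p * q * (v s - w s))
    rw [abs_mul (p - q), abs_mul (p * q)] at h4
    have h5 : 0 ≤ |p - q| * |v s - w s| := by positivity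
    have h6 : 0 ≤ |p * q| * |v' s - w' s| := by positivity
    have h7 : 0 ≤ (α + 1) * M ^ α * |v' s - w' s| := by positivity
    nlinarith

lemma isTrajectory_zero (p q α : ℝ) : IsTrajectory p q α (fun _ => 0) (fun _ => 0) where
  left t := hasDerivAt_const t 0
  right t := by simpa using hasDerivAt_const t (0 : ℝ)

/-! ### Convergence of bounded trajectories -/

lemma exists_tendsto_of_monotoneOn_Ici {h : ℝ → ℝ} {T B : ℝ} (hm : MonotoneOn h (Ici T))
    (hB : ∀ t ≥ T, h t ≤ B) : ∃ L, Tendsto h atTop (𝓝 L) ∧ ∀ t ≥ T, h t ≤ L := by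
  have hmono : Monotone (fun t => h (max t T)) := fun s t hst =>
    hm (le_max_right s T) (le_max_right t T) (max_le_max_right T hst)
  have hbdd : BddAbove (range fun t => h (max t T)) :=
    ⟨B, by rintro _ ⟨t, rfl⟩; exact hB _ (le_max_right t T)⟩
  refine ⟨_, (tendsto_atTop_ciSup hmono hbdd).congr' ?_, fun t ht => ?_⟩
  · filter_upwards [eventually_ge_atTop T] with t ht
    rw [max_eq_left ht]
  · have := le_ciSup hbdd t
    simpa only [max_eq_left ht] using this

lemma exists_tendsto_of_antitoneOn_Ici {h : ℝ → ℝ} {T B : ℝ} (hm : AntitoneOn h (Ici T))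
    (hB : ∀ t ≥ T, B ≤ h t) : ∃ L, Tendsto h atTop (𝓝 L) ∧ ∀ t ≥ T, L ≤ h t := by
  obtain ⟨L, h1, h2⟩ := exists_tendsto_of_monotoneOn_Ici (h := fun t => -h t) (B := -B)
    (fun s hs t ht hst => neg_le_neg (hm hs ht hst)) (fun t ht => neg_le_neg (hB t ht))
  exact ⟨-L, by simpa using h1.neg, fun t ht => by linarith [h2 t ht]⟩

/-- Barbalat's lemma, for a function with bounded second derivative. -/
lemma tendsto_deriv_zero_of_tendsto {h h' h'' : ℝ → ℝ} {T K L : ℝ}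
    (hd : ∀ t, HasDerivAt h (h' t) t) (hd' : ∀ t, HasDerivAt h' (h'' t) t)
    (hK : ∀ t ≥ T, |h'' t| ≤ K) (hL : Tendsto h atTop (𝓝 L)) : Tendsto h' atTop (𝓝 0) := by
  have hK0 : 0 ≤ K := (abs_nonneg _).trans (hK T le_rfl)
  rw [Metric.tendsto_nhds]
  intro ε hε
  -- Over a window of length `δ` the derivative varies by at most `K δ ≤ ε/2`, while the mean slope
  -- there is eventually below `ε/2`.
  set δ := ε / (2 * (K + 1)) with hδ
  have hδ0 : 0 < δ := by positivity
  have hKδ : K * δ ≤ ε / 2 := by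
    rw [hδ]
    have : K * (ε / (2 * (K + 1))) = (K / (K + 1)) * (ε / 2) := by field_simp
    rw [this]
    have : K / (K + 1) ≤ 1 := by rw [div_le_one (by positivity)]; linarith
    nlinarith
  have h1 : Tendsto (fun t => h (t + δ) - h t) atTop (𝓝 0) := by
    simpa using (hL.comp (tendsto_atTop_add_const_right atTop δ tendsto_id)).sub hL
  have h2 := (Metric.tendsto_nhds.1 h1) (ε / 2 * δ) (by positivity)
  filter_upwards [h2, eventually_ge_atTop T] with t ht htT
  rw [Real.dist_eq, sub_zero] at ht ⊢
  obtain ⟨ξ, hξ, hs⟩ := exists_hasDerivAt_eq_slope h h' (show t < t + δ by linarith)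
    (fun s _ => (hd s).continuousAt.continuousWithinAt) (fun s _ => hd s)
  have h3 : |h' ξ| < ε / 2 := by
    rw [hs, abs_div, show t + δ - t = δ by ring, abs_of_pos hδ0, div_lt_iff₀ hδ0]
    exact ht
  have h4 := (convex_Ici T).norm_image_sub_le_of_norm_hasDerivWithin_le (f := h') (f' := h'')
    (C := K) (x := ξ) (y := t) (fun s _ => (hd' s).hasDerivWithinAt) (fun s hs => hK s hs)
    (show T ≤ ξ by linarith [hξ.1]) (show T ≤ t from htT)
  rw [Real.norm_eq_abs, Real.norm_eq_abs] at h4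
  have h5 : |t - ξ| ≤ δ := by rw [abs_le]; constructor <;> linarith [hξ.1, hξ.2]
  have h6 : |h' t| ≤ |h' t - h' ξ| + |h' ξ| := by
    have := abs_add_le (h' t - h' ξ) (h' ξ); simpa using this
  have h7 : K * |t - ξ| ≤ K * δ := by gcongr
  linarith

lemma frequently_eq_of_frequently_lt_gt {v : ℝ → ℝ} (hv : Continuous v) {a c b : ℝ} (hac : a < c)
    (hcb : c < b) (h1 : ∃ᶠ t in atTop, v t < a) (h2 : ∃ᶠ t in atTop, b < v t) :
    ∃ᶠ t in atTop, v t = c := by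
  rw [frequently_atTop] at *
  intro T
  obtain ⟨s, hs, hsa⟩ := h1 T
  obtain ⟨t, ht, htb⟩ := h2 T
  obtain ⟨x, hx, hxc⟩ := (isPreconnected_Ici (a := T)).intermediate_value hs ht hv.continuousOn
    (show c ∈ Icc (v s) (v t) from ⟨by linarith, by linarith⟩)
  exact ⟨x, hx, hxc⟩

/-- A bounded continuous function along which a continuous function with finitely many zeros
tends to zero converges to one of these zeros. -/
lemma exists_tendsto_of_comp_tendsto_zero {v g : ℝ → ℝ} {T M : ℝ} (hv : Continuous v)
    (hg : Continuous g) (hM : ∀ t ≥ T, |v t| ≤ M) (hfin : {x | g x = 0}.Finite)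
    (h : Tendsto (fun t => g (v t)) atTop (𝓝 0)) : ∃ l, g l = 0 ∧ Tendsto v atTop (𝓝 l) := by
  have hb1 : IsBoundedUnder (· ≤ ·) atTop v :=
    ⟨M, by
      rw [eventually_map]
      filter_upwards [eventually_ge_atTop T] with t ht using (abs_le.1 (hM t ht)).2⟩
  have hb2 : IsBoundedUnder (· ≥ ·) atTop v :=
    ⟨-M, by
      rw [eventually_map]
      filter_upwards [eventually_ge_atTop T] with t ht using (abs_le.1 (hM t ht)).1⟩
  -- An interval crossed infinitely often contains a point `c` with `g c ≠ 0`, since `g` has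
  -- finitely many zeros; `v` then takes the value `c` at arbitrarily large times, against `g ∘ v →
  -- 0`.
  obtain ⟨l, hl⟩ := tendsto_of_no_upcrossings (u := v) (f := atTop) (dense_univ (X := ℝ))
    (by
      rintro a - b - hab ⟨h1, h2⟩
      obtain ⟨c, hc, hgc⟩ := ((Ioo_infinite hab).sdiff hfin).nonempty
      have h3 := frequently_eq_of_frequently_lt_gt hv hc.1 hc.2 h1 h2
      have hgc : g c ≠ 0 := hgc
      have h4 := (Metric.tendsto_nhds.1 h) |g c| (abs_pos.2 hgc)
      obtain ⟨t, ht, ht'⟩ := (h3.and_eventually h4).exists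
      rw [Real.dist_eq, sub_zero, ht] at ht'
      exact lt_irrefl _ ht') hb1 hb2
  exact ⟨l, tendsto_nhds_unique ((hg.tendsto l).comp hl) h, hl⟩

lemma equilibrium_iff {β α x : ℝ} (hβ : 0 < β) (hα : 0 < α) :
    β * x - |x| ^ α * x = 0 ↔ x = 0 ∨ x = β ^ (1 / α) ∨ x = -β ^ (1 / α) := by
  have h1 : β * x - |x| ^ α * x = 0 ↔ x = 0 ∨ |x| = β ^ (1 / α) := by
    rw [show β * x - |x| ^ α * x = (β - |x| ^ α) * x by ring, mul_eq_zero, sub_eq_zero, or_comm]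
    refine or_congr_right ⟨fun h => ?_, fun h => ?_⟩
    · rw [h, one_div, Real.rpow_rpow_inv (abs_nonneg x) hα.ne']
    · rw [h, one_div, Real.rpow_inv_rpow hβ.le hα.ne']
  rw [h1, abs_eq (Real.rpow_nonneg hβ.le _)]

lemma equilibrium_finite {β α : ℝ} (hβ : 0 < β) (hα : 0 < α) :
    {x : ℝ | β * x - |x| ^ α * x = 0}.Finite := by
  have : {x : ℝ | β * x - |x| ^ α * x = 0} = {0, β ^ (1 / α), -β ^ (1 / α)} := by
    ext x; simp only [mem_ofPred_eq, equilibrium_iff hβ hα]; simp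
  rw [this]; exact toFinite _

/-- The energy is monotone and bounded, so it converges. Barbalat's lemma applied to the energy
gives `v' → 0`, and applied to `v'` it gives `v'' → 0`; hence the force `p q v - |v|^α v` tends to
`0`. Only `p ≠ q` is asked, so that reversed trajectories are covered. -/
lemma IsTrajectory.exists_tendsto_of_bounded {p q α T M : ℝ} (hp : 0 < p) (hq : 0 < q)
    (hpq : p ≠ q) (hα : 0 < α) {v v' : ℝ → ℝ} (h : IsTrajectory p q α v v')
    (hv : ∀ t ≥ T, |v t| ≤ M) (hv' : ∀ t ≥ T, |v' t| ≤ M) :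
    Tendsto v' atTop (𝓝 0) ∧
      ∃ l, p * q * l - |l| ^ α * l = 0 ∧ Tendsto v atTop (𝓝 l) := by
  have hM : 0 ≤ M := (abs_nonneg _).trans (hv T le_rfl)
  set A : ℝ → ℝ := fun t => (p - q) * v' t + p * q * v t - |v t| ^ α * v t with hA
  set B : ℝ := |p - q| * M + p * q * M + M ^ α * M with hB
  have hAB : ∀ t ≥ T, |A t| ≤ B := by
    intro t ht
    have h1 := abs_sub ((p - q) * v' t + p * q * v t) (|v t| ^ α * v t)
    have h2 := abs_add_le ((p - q) * v' t) (p * q * v t)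
    rw [abs_mul] at h2
    rw [abs_mul (p * q), abs_of_pos (mul_pos hp hq)] at h2
    rw [abs_mul (|v t| ^ α), abs_of_nonneg (Real.rpow_nonneg (abs_nonneg _) _)] at h1
    have h3 : |p - q| * |v' t| ≤ |p - q| * M := by gcongr; exact hv' t ht
    have h4 : p * q * |v t| ≤ p * q * M := by gcongr; exact hv t ht
    have h5 : |v t| ^ α * |v t| ≤ M ^ α * M := by gcongr <;> exact hv t ht
    simp only [hA, hB]
    linarith
  have hBnn : 0 ≤ B := (abs_nonneg _).trans (hAB T le_rfl)
  have hE := h.hasDerivAt_energy hα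
  have hEbd : ∀ t ≥ T, |trajEnergy p q α v v' t| ≤
      M ^ 2 / 2 + p * q * M ^ 2 / 2 + M ^ (α + 2) / (α + 2) := by
    intro t ht
    have h1 : v' t ^ 2 ≤ M ^ 2 := by
      rw [← sq_abs]; have := hv' t ht; gcongr
    have h2 : v t ^ 2 ≤ M ^ 2 := by
      rw [← sq_abs]; have := hv t ht; gcongr
    have h3 : |v t| ^ (α + 2) / (α + 2) ≤ M ^ (α + 2) / (α + 2) := by
      have := hv t ht; gcongr
    have h4 : 0 ≤ |v t| ^ (α + 2) / (α + 2) := by positivity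
    have h5 : p * q * v t ^ 2 / 2 ≤ p * q * M ^ 2 / 2 := by gcongr
    have h6 : 0 ≤ p * q * v t ^ 2 / 2 := by positivity
    unfold trajEnergy
    rw [abs_le]
    constructor <;> nlinarith [sq_nonneg (v' t), sq_nonneg M]
  have hElim : ∃ L, Tendsto (trajEnergy p q α v v') atTop (𝓝 L) := by
    rcases lt_or_gt_of_ne hpq with hlt | hlt
    · have hm := antitoneOn_of_hasDerivAt (convex_Ici T) (fun t _ => hE t)
        (fun t _ => mul_nonpos_of_nonpos_of_nonneg (by linarith) (sq_nonneg _))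
      obtain ⟨L, hL, -⟩ := exists_tendsto_of_antitoneOn_Ici hm
        (fun t ht => (abs_le.1 (hEbd t ht)).1)
      exact ⟨L, hL⟩
    · have hm := monotoneOn_of_hasDerivAt (convex_Ici T) (fun t _ => hE t)
        (fun t _ => mul_nonneg (by linarith) (sq_nonneg _))
      obtain ⟨L, hL, -⟩ := exists_tendsto_of_monotoneOn_Ici hm
        (fun t ht => (abs_le.1 (hEbd t ht)).2)
      exact ⟨L, hL⟩
  obtain ⟨L, hL⟩ := hElim
  have hsq : Tendsto (fun t => (p - q) * v' t ^ 2) atTop (𝓝 0) := by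
    refine tendsto_deriv_zero_of_tendsto (T := T) (K := |p - q| * (2 * M * B))
      (h'' := fun t => (p - q) * (2 * v' t * A t)) hE (fun t => ?_) (fun t ht => ?_) hL
    · refine (((h.right t).pow 2).const_mul (p - q)).congr_deriv ?_
      simp [hA]
    · rw [abs_mul, abs_mul, abs_mul, abs_two]
      have := hv' t ht
      have := hAB t ht
      gcongr
  have hv'0 : Tendsto v' atTop (𝓝 0) := by
    have h1 : Tendsto (fun t => v' t ^ 2) atTop (𝓝 0) := by
      have := hsq.const_mul (p - q)⁻¹
      rw [mul_zero] at this
      refine this.congr fun t => ?_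
      rw [← mul_assoc, inv_mul_cancel₀ (sub_ne_zero.2 hpq), one_mul]
    have h2 := (Real.continuous_sqrt.tendsto 0).comp h1
    rw [Real.sqrt_zero] at h2
    rw [tendsto_zero_iff_abs_tendsto_zero]
    refine h2.congr fun t => ?_
    simp [Real.sqrt_sq_eq_abs]
  have hA0 : Tendsto A atTop (𝓝 0) := by
    refine tendsto_deriv_zero_of_tendsto (T := T) (h := v')
      (K := |p - q| * B + p * q * M + (α + 1) * M ^ α * M)
      (h'' := fun t => (p - q) * A t + p * q * v' t - (α + 1) * |v t| ^ α * v' t)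
      h.right (fun t => ?_) (fun t ht => ?_) hv'0
    · exact (((h.right t).const_mul (p - q)).add ((h.left t).const_mul (p * q))).sub
        ((hasDerivAt_abs_rpow_mul_self hα (v t)).comp t (h.left t))
    · have h1 := abs_sub ((p - q) * A t + p * q * v' t) ((α + 1) * |v t| ^ α * v' t)
      have h2 := abs_add_le ((p - q) * A t) (p * q * v' t)
      rw [abs_mul] at h2
      rw [abs_mul (p * q), abs_of_pos (mul_pos hp hq)] at h2
      rw [abs_mul ((α + 1) * |v t| ^ α),
        abs_of_nonneg (show 0 ≤ (α + 1) * |v t| ^ α by positivity)] at h1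
      have h3 : |p - q| * |A t| ≤ |p - q| * B := by gcongr; exact hAB t ht
      have h4 : p * q * |v' t| ≤ p * q * M := by gcongr; exact hv' t ht
      have h5 : (α + 1) * |v t| ^ α * |v' t| ≤ (α + 1) * M ^ α * M := by
        have := hv t ht
        have := hv' t ht
        gcongr
      linarith
  have hg0 : Tendsto (fun t => p * q * v t - |v t| ^ α * v t) atTop (𝓝 0) := by
    have := hA0.sub (hv'0.const_mul (p - q))
    simp only [mul_zero, sub_zero] at this
    refine this.congr fun t => ?_
    simp only [hA]; ring
  exact ⟨hv'0, exists_tendsto_of_comp_tendsto_zero (g := fun x => p * q * x - |x| ^ α * x)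
    h.continuous_left
    ((continuous_const.mul continuous_id).sub (continuous_abs_rpow_mul_self hα)) hv
    (equilibrium_finite (mul_pos hp hq) hα) hg0⟩

/-! ### Perturbations of the linear equation `d'' = (p - q) d' + p q d` -/

/-- `d'' = (p - q) d' + p q d - g` on `[T, ∞)` and `d, d' → 0` at infinity. -/
structure IsDecayingPerturbation (p q T : ℝ) (d d' g : ℝ → ℝ) : Prop where
  left : ∀ t ≥ T, HasDerivAt d (d' t) t
  right : ∀ t ≥ T, HasDerivAt d' ((p - q) * d' t + p * q * d t - g t) t
  lim : Tendsto d atTop (𝓝 0)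
  lim' : Tendsto d' atTop (𝓝 0)

namespace IsDecayingPerturbation

variable {p q T : ℝ} {d d' g : ℝ → ℝ}

lemma mono (h : IsDecayingPerturbation p q T d d' g) {S : ℝ} (hS : T ≤ S) :
    IsDecayingPerturbation p q S d d' g :=
  ⟨fun t ht => h.left t (hS.trans ht), fun t ht => h.right t (hS.trans ht), h.lim, h.lim'⟩

/-- The operator factors as `(D - p)(D + q)`. Thus `y = d' - p d` contracts at rate `q`, and `z = d'
+ q d` expands at rate `p`, up to the perturbation. -/
lemma hasDerivAt_stable (h : IsDecayingPerturbation p q T d d' g) {t : ℝ} (ht : T ≤ t) :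
    HasDerivAt (fun t => d' t - p * d t) (-q * (d' t - p * d t) - g t) t :=
  ((h.right t ht).sub ((h.left t ht).const_mul p)).congr_deriv (by ring)

lemma hasDerivAt_unstable (h : IsDecayingPerturbation p q T d d' g) {t : ℝ} (ht : T ≤ t) :
    HasDerivAt (fun t => d' t + q * d t) (p * (d' t + q * d t) - g t) t :=
  ((h.right t ht).add ((h.left t ht).const_mul q)).congr_deriv (by ring)

/-- The stable component dominates the unstable one. -/
lemma sq_unstable_le (h : IsDecayingPerturbation p q T d d' g) (hp : 0 < p) (hq : 0 < q)
    {ε : ℝ} (hεp : 4 * ε ≤ p * (p + q)) (hεq : 4 * ε ≤ q * (p + q))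
    (hg : ∀ t ≥ T, |g t| ≤ ε * |d t|) {t : ℝ} (ht : T ≤ t) :
    (d' t + q * d t) ^ 2 ≤ (d' t - p * d t) ^ 2 := by
  -- For small `g` the difference `z² - y²` is nondecreasing; since it tends to `0` at infinity, it
  -- is nonpositive throughout.
  have hm := monotoneOn_of_hasDerivAt (convex_Ici T)
    (h := fun t => (d' t + q * d t) ^ 2 - (d' t - p * d t) ^ 2)
    (fun t ht => ((h.hasDerivAt_unstable ht).pow 2).sub ((h.hasDerivAt_stable ht).pow 2)) ?_
  · have hlim : Tendsto (fun t => (d' t + q * d t) ^ 2 - (d' t - p * d t) ^ 2) atTop (𝓝 0) := by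
      have := ((h.lim'.add (h.lim.const_mul q)).pow 2).sub
        ((h.lim'.sub (h.lim.const_mul p)).pow 2)
      simpa using this
    have : (d' t + q * d t) ^ 2 - (d' t - p * d t) ^ 2 ≤ 0 :=
      ge_of_tendsto hlim (by
        filter_upwards [eventually_ge_atTop t] with s hs
        exact hm ht (ht.trans hs) hs)
    linarith
  · intro t ht
    have hgt := hg t ht
    set y := d' t - p * d t with hy
    set z := d' t + q * d t with hz
    have hd : d t = (z - y) / (p + q) := by
      rw [hy, hz]; field_simp; ring
    have hgd : |g t * d t| ≤ ε * d t ^ 2 := by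
      rw [abs_mul, ← sq_abs (d t), sq, ← mul_assoc]
      gcongr
    have h1 : g t * (z - y) = (p + q) * (g t * d t) := by rw [hd]; field_simp
    have h2 : (z - y) ^ 2 = (p + q) ^ 2 * d t ^ 2 := by rw [hd]; field_simp
    have h3 := (abs_le.1 hgd).2
    have h4 : (p + q) * (g t * d t) ≤ (p + q) * (ε * d t ^ 2) := by gcongr
    have h5 : (p + q) * (4 * ε) * d t ^ 2 ≤ p * (z - y) ^ 2 := by
      rw [h2]
      have : (p + q) * (4 * ε) * d t ^ 2 ≤ (p + q) * (p * (p + q)) * d t ^ 2 := by gcongr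
      nlinarith
    have h6 : (p + q) * (4 * ε) * d t ^ 2 ≤ q * (z - y) ^ 2 := by
      rw [h2]
      have : (p + q) * (4 * ε) * d t ^ 2 ≤ (p + q) * (q * (p + q)) * d t ^ 2 := by gcongr
      nlinarith
    have h7 : (z - y) ^ 2 ≤ 2 * (z ^ 2 + y ^ 2) := by nlinarith [sq_nonneg (z + y)]
    push_cast
    simp only [pow_one]
    rcases le_total p q with hle | hle
    · have : p * (z ^ 2 + y ^ 2) ≤ p * z ^ 2 + q * y ^ 2 := by nlinarith [sq_nonneg y]
      nlinarith
    · have : q * (z ^ 2 + y ^ 2) ≤ p * z ^ 2 + q * y ^ 2 := by nlinarith [sq_nonneg z]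
      nlinarith

lemma abs_le_stable (hp : 0 < p) (hq : 0 < q) {t : ℝ}
    (h : (d' t + q * d t) ^ 2 ≤ (d' t - p * d t) ^ 2) :
    |d t| ≤ 2 / (p + q) * |d' t - p * d t| := by
  have h1 := sq_le_sq.1 h
  have h3 : d' t + q * d t - (d' t - p * d t) = (p + q) * d t := by ring
  have h4 : |(p + q) * d t| ≤ 2 * |d' t - p * d t| := by
    rw [← h3]
    exact (abs_sub_le _ 0 _).trans (by simp only [sub_zero, zero_sub, abs_neg]; linarith)
  rw [abs_mul, abs_of_pos (by linarith : 0 < p + q)] at h4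
  rw [div_mul_eq_mul_div, le_div_iff₀ (by linarith)]
  linarith

/-- Exponential decay with half of the optimal rate. -/
lemma exists_abs_le_exp (h : IsDecayingPerturbation p q T d d' g) (hp : 0 < p) (hq : 0 < q)
    {ε : ℝ} (hεp : 4 * ε ≤ p * (p + q)) (hεq : 4 * ε ≤ q * (p + q))
    (hg : ∀ t ≥ T, |g t| ≤ ε * |d t|) :
    ∃ C, 0 ≤ C ∧ ∀ t ≥ T, |d t| ≤ C * Real.exp (-(q / 2) * t) := by
  have hcone := fun t (ht : T ≤ t) => h.sq_unstable_le hp hq hεp hεq hg ht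
  -- In the cone `|z| ≤ |y|` one has `|g y| ≤ (q/2) y²`, hence `(y²)' ≤ -q y²`: half of the linear
  -- rate is given up to absorb `g`.
  have hm := antitoneOn_of_hasDerivAt (convex_Ici T)
    (h := fun t => Real.exp (q * t) * (d' t - p * d t) ^ 2)
    (fun t ht => (((hasDerivAt_id t).const_mul q).exp).mul ((h.hasDerivAt_stable ht).pow 2)) ?_
  · set C₀ := Real.exp (q * T) * (d' T - p * d T) ^ 2 with hC₀
    have hC₀nn : 0 ≤ C₀ := by positivity
    refine ⟨2 / (p + q) * √C₀, by positivity, fun t ht => ?_⟩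
    refine (abs_le_stable hp hq (hcone t ht)).trans ?_
    rw [mul_assoc]
    gcongr
    have h1 : Real.exp (q * t) * (d' t - p * d t) ^ 2 ≤ C₀ := hm self_mem_Ici ht ht
    refine abs_le_of_sq_le_sq ?_ (by positivity)
    rw [mul_pow, Real.sq_sqrt hC₀nn, ← Real.exp_nat_mul]
    have h2 : Real.exp (((2 : ℕ) : ℝ) * (-(q / 2) * t)) * Real.exp (q * t) = 1 := by
      rw [← Real.exp_add]; push_cast; ring_nf; exact Real.exp_zero
    calc (d' t - p * d t) ^ 2
        = Real.exp (((2 : ℕ) : ℝ) * (-(q / 2) * t))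
            * (Real.exp (q * t) * (d' t - p * d t) ^ 2) := by
          rw [← mul_assoc, h2, one_mul]
      _ ≤ Real.exp (((2 : ℕ) : ℝ) * (-(q / 2) * t)) * C₀ := by gcongr
      _ = _ := mul_comm _ _
  · intro t ht
    have h1 := abs_le_stable hp hq (hcone t ht)
    have h2 := hg t ht
    set y := d' t - p * d t
    have h3 : |g t * y| ≤ (q / 2) * y ^ 2 := by
      rw [abs_mul, ← sq_abs y]
      rcases le_or_gt ε 0 with hε | hε
      · have : |g t| ≤ 0 := h2.trans (mul_nonpos_of_nonpos_of_nonneg hε (abs_nonneg _))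
        have := mul_le_mul_of_nonneg_right this (abs_nonneg y)
        have : 0 ≤ q / 2 * |y| ^ 2 := by positivity
        linarith
      · have h4 : |g t| ≤ ε * (2 / (p + q) * |y|) := h2.trans (by gcongr)
        have h5 : ε * (2 / (p + q)) ≤ q / 2 := by
          rw [mul_div_assoc', div_le_iff₀ (by linarith)]; linarith
        calc |g t| * |y| ≤ ε * (2 / (p + q) * |y|) * |y| := by gcongr
          _ = ε * (2 / (p + q)) * |y| ^ 2 := by ring
          _ ≤ _ := by gcongr
    have h4 := (abs_le.1 h3).1
    have : Real.exp (q * t) * (q * 1) * y ^ 2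
        + Real.exp (q * t) * (2 * y * (-q * y - g t)) ≤ 0 := by
      have : Real.exp (q * t) * (q * 1) * y ^ 2
        + Real.exp (q * t) * (2 * y * (-q * y - g t))
        = -2 * Real.exp (q * t) * (q / 2 * y ^ 2 + g t * y) := by ring
      rw [this]
      have := mul_nonneg (Real.exp_pos (q * t)).le (by linarith : 0 ≤ q / 2 * y ^ 2 + g t * y)
      linarith
    simpa using this

/-- If the perturbation is exponentially small relative to `d`, then `e^{q t} d` converges,
and the limit vanishes only for the trivial solution. -/
lemma exists_tendsto_exp_mul (h : IsDecayingPerturbation p q T d d' g) (hp : 0 < p) (hq : 0 < q)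
    {K δ : ℝ} (hK : 0 ≤ K) (hδ : 0 < δ)
    (hg : ∀ t ≥ T, |g t| ≤ K * Real.exp (-δ * t) * |d t|) :
    ∃ L, Tendsto (fun t => Real.exp (q * t) * d t) atTop (𝓝 L) ∧
      (L = 0 → ∃ t, d t = 0 ∧ d' t = 0) := by
  have hexp : ∀ c : ℝ, 0 < c → Tendsto (fun t => Real.exp (-c * t)) atTop (𝓝 0) := fun c hc =>
    Real.tendsto_exp_atBot.comp (tendsto_id.const_mul_atTop_of_neg (by linarith))
  -- Past some `S` the factor `K e^{-δt}` is below the threshold of the cone estimate.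
  obtain ⟨S, hTS, hS⟩ : ∃ S, T ≤ S ∧ ∀ t ≥ S, (d' t + q * d t) ^ 2 ≤ (d' t - p * d t) ^ 2 := by
    set ε := min p q * (p + q) / 4 with hε
    have hε0 : 0 < ε := by have := lt_min hp hq; positivity
    have h1 := ((hexp δ hδ).const_mul K).eventually (gt_mem_nhds (by simpa using hε0))
    obtain ⟨S, hS⟩ := eventually_atTop.1 (h1.and (eventually_ge_atTop T))
    refine ⟨S, (hS S le_rfl).2, fun t ht => ?_⟩
    refine (h.mono (hS S le_rfl).2).sq_unstable_le (ε := ε) hp hq ?_ ?_ (fun s hs => ?_) ht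
    · have := mul_le_mul_of_nonneg_right (min_le_left p q) (by linarith : 0 ≤ p + q); linarith
    · have := mul_le_mul_of_nonneg_right (min_le_right p q) (by linarith : 0 ≤ p + q); linarith
    · exact (hg s (hS s hs).2).trans
        (mul_le_mul_of_nonneg_right (hS s hs).1.le (abs_nonneg _))
  -- The rescaled stable component satisfies `|η'| ≤ K₁ e^{-δt} |η|` past `S`, with an integrable
  -- coefficient.
  set η : ℝ → ℝ := fun t => Real.exp (q * t) * (d' t - p * d t) with hη
  set η' : ℝ → ℝ := fun t => -(Real.exp (q * t) * g t) with hη'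
  set K₁ := K * (2 / (p + q)) with hK₁
  have hK₁0 : 0 ≤ K₁ := by positivity
  have hηd : ∀ t ≥ S, HasDerivAt η (η' t) t := fun t ht => by
    refine ((((hasDerivAt_id t).const_mul q).exp).mul
      (h.hasDerivAt_stable (hTS.trans ht))).congr_deriv ?_
    simp only [hη', id]; ring
  have hη'b : ∀ t ≥ S, |η' t| ≤ K₁ * Real.exp (-δ * t) * |η t| := by
    intro t ht
    simp only [hη, hη', abs_neg, abs_mul, abs_of_pos (Real.exp_pos (q * t))]
    have h1 := abs_le_stable hp hq (hS t ht)
    calc Real.exp (q * t) * |g t|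
        ≤ Real.exp (q * t) * (K * Real.exp (-δ * t) * (2 / (p + q) * |d' t - p * d t|)) := by
          gcongr; exact (hg t (hTS.trans ht)).trans (by gcongr)
      _ = _ := by rw [hK₁]; ring
  have hw : ∀ s t : ℝ, HasDerivAt (fun t => Real.exp (s * Real.exp (-δ * t)))
      (-(s * δ) * Real.exp (-δ * t) * Real.exp (s * Real.exp (-δ * t))) t := fun s t => by
    refine (((((hasDerivAt_id t).const_mul (-δ)).exp).const_mul s).exp).congr_deriv ?_
    simp only [id]; ring
  have hηη : ∀ t ≥ S, |η t * η' t| ≤ K₁ * Real.exp (-δ * t) * η t ^ 2 := fun t ht => by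
    rw [abs_mul, ← sq_abs (η t)]
    calc |η t| * |η' t| ≤ |η t| * (K₁ * Real.exp (-δ * t) * |η t|) := by
          gcongr; exact hη'b t ht
      _ = _ := by ring
  -- The factors `exp(±(2K₁/δ) e^{-δt})` integrate the inequality `|(η²)'| ≤ 2 K₁ e^{-δt} η²`. The
  -- decreasing product bounds `η`; the increasing one prevents a nonzero `η` from tending to `0`.
  have hanti : AntitoneOn (fun t => η t ^ 2 * Real.exp ((2 * K₁ / δ) * Real.exp (-δ * t)))
      (Ici S) := by
    refine antitoneOn_of_hasDerivAt (convex_Ici S)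
      (fun t ht => ((hηd t ht).pow 2).mul (hw _ t)) fun t ht => ?_
    have h1 := (abs_le.1 (hηη t ht)).2
    have h2 : 2 * K₁ / δ * δ = 2 * K₁ := by field_simp
    rw [h2]
    have h3 := mul_nonneg (Real.exp_pos ((2 * K₁ / δ) * Real.exp (-δ * t))).le
      (by linarith : 0 ≤ K₁ * Real.exp (-δ * t) * η t ^ 2 - η t * η' t)
    simp only [Pi.pow_apply]
    push_cast
    nlinarith
  have hmono : MonotoneOn (fun t => η t ^ 2 * Real.exp ((-(2 * K₁ / δ)) * Real.exp (-δ * t)))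
      (Ici S) := by
    refine monotoneOn_of_hasDerivAt (convex_Ici S)
      (fun t ht => ((hηd t ht).pow 2).mul (hw _ t)) fun t ht => ?_
    have h1 := (abs_le.1 (hηη t ht)).1
    have h2 : -(-(2 * K₁ / δ) * δ) = 2 * K₁ := by field_simp
    rw [h2]
    have h3 := mul_nonneg (Real.exp_pos (-(2 * K₁ / δ) * Real.exp (-δ * t))).le
      (by linarith : 0 ≤ K₁ * Real.exp (-δ * t) * η t ^ 2 + η t * η' t)
    simp only [Pi.pow_apply]
    push_cast
    nlinarith
  obtain ⟨C, hC, hηC⟩ : ∃ C, 0 ≤ C ∧ ∀ t ≥ S, |η t| ≤ C := by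
    refine ⟨√(η S ^ 2 * Real.exp ((2 * K₁ / δ) * Real.exp (-δ * S))), by positivity,
      fun t ht => Real.abs_le_sqrt (le_trans ?_ (hanti self_mem_Ici ht ht))⟩
    exact le_mul_of_one_le_right (sq_nonneg _) (Real.one_le_exp (by positivity))
  obtain ⟨L, hL⟩ : ∃ L, Tendsto η atTop (𝓝 L) := by
    have hm := monotoneOn_of_hasDerivAt (convex_Ici S)
      (h := fun t => η t - K₁ * C / δ * Real.exp (-δ * t))
      (fun t ht => (hηd t ht).sub ((((hasDerivAt_id t).const_mul (-δ)).exp).const_mul _))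
      (fun t ht => by
        have h1 := (abs_le.1 (hη'b t ht)).1
        have h2 : K₁ * Real.exp (-δ * t) * |η t| ≤ K₁ * Real.exp (-δ * t) * C := by
          gcongr; exact hηC t ht
        have h3 : K₁ * C / δ * (Real.exp (-δ * t) * (-δ * 1)) = -(K₁ * Real.exp (-δ * t) * C) := by
          field_simp
        simp only [id]
        rw [h3]; linarith)
    obtain ⟨L, hL, -⟩ := exists_tendsto_of_monotoneOn_Ici hm (B := C) (fun t ht => by
      have := (abs_le.1 (hηC t ht)).2
      have : 0 ≤ K₁ * C / δ * Real.exp (-δ * t) := by positivity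
      linarith)
    refine ⟨L, ?_⟩
    have := hL.add ((hexp δ hδ).const_mul (K₁ * C / δ))
    simpa using this
  -- Since `(e^{-pt} d)' = e^{-pt} y`, L'Hôpital's rule for `e^{-pt} d / e^{-(p+q)t}` passes from
  -- the limit of `η` to that of `e^{qt} d`.
  have hξ : Tendsto (fun t => Real.exp (q * t) * d t) atTop (𝓝 (-L / (p + q))) := by
    have h1 : Tendsto (fun t => (Real.exp (-p * t) * d t) / Real.exp (-(p + q) * t)) atTop
        (𝓝 (-L / (p + q))) := by
      refine HasDerivAt.lhopital_zero_atTop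
        (f' := fun t => Real.exp (-p * t) * (d' t - p * d t))
        (g' := fun t => -(p + q) * Real.exp (-(p + q) * t)) ?_ ?_ ?_ ?_ (hexp _ (by linarith)) ?_
      · filter_upwards [eventually_ge_atTop S] with t ht
        refine ((((hasDerivAt_id t).const_mul (-p)).exp).mul
          (h.left t (hTS.trans ht))).congr_deriv ?_
        simp only [id]; ring
      · refine Eventually.of_forall fun t => ?_
        refine (((hasDerivAt_id t).const_mul (-(p + q))).exp).congr_deriv ?_
        simp only [id]; ring
      · refine Eventually.of_forall fun t => ?_
        exact mul_ne_zero (by linarith) (Real.exp_pos _).ne'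
      · simpa using (hexp p hp).mul h.lim
      · refine (hL.neg.div_const (p + q)).congr fun t => ?_
        have : Real.exp (-p * t) = Real.exp (q * t) * Real.exp (-(p + q) * t) := by
          rw [← Real.exp_add]; ring_nf
        simp only [hη, this]
        have := (Real.exp_pos (-(p + q) * t)).ne'
        field_simp
    refine h1.congr fun t => ?_
    have : Real.exp (-p * t) = Real.exp (q * t) * Real.exp (-(p + q) * t) := by
      rw [← Real.exp_add]; ring_nf
    rw [this]
    have := (Real.exp_pos (-(p + q) * t)).ne'
    field_simp
  refine ⟨_, hξ, fun hL0 => ⟨S, ?_⟩⟩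
  have hL0 : L = 0 := by
    rw [div_eq_zero_iff] at hL0
    rcases hL0 with h0 | h0 <;> linarith
  rw [hL0] at hL
  -- A nonnegative nondecreasing function with limit `0` vanishes; so `y = 0` at `S`, and the cone
  -- condition then gives `d = d' = 0` there.
  have hlim : Tendsto (fun t => η t ^ 2 * Real.exp ((-(2 * K₁ / δ)) * Real.exp (-δ * t))) atTop
      (𝓝 0) := by
    have := (hL.pow 2).mul ((Real.continuous_exp.tendsto _).comp
      ((hexp δ hδ).const_mul (-(2 * K₁ / δ))))
    simpa using this
  have h0 : η S ^ 2 * Real.exp ((-(2 * K₁ / δ)) * Real.exp (-δ * S)) ≤ 0 :=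
    ge_of_tendsto hlim (by
      filter_upwards [eventually_ge_atTop S] with s hs
      exact hmono self_mem_Ici hs hs)
  have h1 : η S = 0 := by
    by_contra hne
    have : 0 < η S ^ 2 * Real.exp ((-(2 * K₁ / δ)) * Real.exp (-δ * S)) := by positivity
    linarith
  have h2 : d' S - p * d S = 0 := by
    simpa [hη, (Real.exp_pos _).ne'] using h1
  have h3 := abs_le_stable hp hq (hS S le_rfl)
  rw [h2, abs_zero, mul_zero] at h3
  have h4 : d S = 0 := abs_eq_zero.1 (le_antisymm h3 (abs_nonneg _))
  exact ⟨h4, by simpa [h4] using h2⟩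

end IsDecayingPerturbation

/-! ### Trajectories converging to the origin -/

lemma IsTrajectory.isDecayingPerturbation {p q α : ℝ} {v v' : ℝ → ℝ}
    (h : IsTrajectory p q α v v') (hv : Tendsto v atTop (𝓝 0)) (hv' : Tendsto v' atTop (𝓝 0))
    (T : ℝ) : IsDecayingPerturbation p q T v v' (fun t => |v t| ^ α * v t) :=
  ⟨fun t _ => h.left t, fun t _ => h.right t, hv, hv'⟩

/-- The rate `q/2` is not sharp, but it makes the nonlinearity an exponentially small multiple of
its argument, as the sharp asymptotics require. -/
lemma IsTrajectory.exists_abs_le_exp {p q α : ℝ} (hp : 0 < p) (hq : 0 < q) (hα : 0 < α)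
    {v v' : ℝ → ℝ} (h : IsTrajectory p q α v v') (hv : Tendsto v atTop (𝓝 0))
    (hv' : Tendsto v' atTop (𝓝 0)) :
    ∃ T C, 0 ≤ C ∧ ∀ t ≥ T, |v t| ≤ C * Real.exp (-(q / 2) * t) := by
  set ε := min p q * (p + q) / 4 with hε
  have hε0 : 0 < ε := by have := lt_min hp hq; positivity
  have h1 : Tendsto (fun t => |v t| ^ α) atTop (𝓝 0) := by
    have := ((continuous_abs.rpow_const (fun _ => Or.inr hα.le)).tendsto (0 : ℝ)).comp hv
    simpa [Function.comp_def, Real.zero_rpow hα.ne'] using this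
  obtain ⟨T, hT⟩ := eventually_atTop.1 (h1.eventually (gt_mem_nhds hε0))
  obtain ⟨C, hC⟩ := (h.isDecayingPerturbation hv hv' T).exists_abs_le_exp hp hq (ε := ε)
    (by have := mul_le_mul_of_nonneg_right (min_le_left p q) (by linarith : 0 ≤ p + q); linarith)
    (by have := mul_le_mul_of_nonneg_right (min_le_right p q) (by linarith : 0 ≤ p + q); linarith)
    (fun t ht => by
      rw [abs_mul, abs_of_nonneg (by positivity)]
      exact mul_le_mul_of_nonneg_right (hT t ht).le (abs_nonneg _))
  exact ⟨T, C, hC⟩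

/-- Two trajectories converging to the origin have a difference with exact decay rate `q`. -/
lemma IsTrajectory.exists_tendsto_exp_mul_sub {p q α : ℝ} (hp : 0 < p) (hq : 0 < q) (hα : 0 < α)
    {v v' w w' : ℝ → ℝ} (h : IsTrajectory p q α v v') (hv : Tendsto v atTop (𝓝 0))
    (hv' : Tendsto v' atTop (𝓝 0)) (k : IsTrajectory p q α w w') (hw : Tendsto w atTop (𝓝 0))
    (hw' : Tendsto w' atTop (𝓝 0)) :
    ∃ L, Tendsto (fun t => Real.exp (q * t) * (v t - w t)) atTop (𝓝 L) ∧
      (L = 0 → ∀ t, v t = w t) := by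
  obtain ⟨T₁, C₁, hC₁, h1⟩ := h.exists_abs_le_exp hp hq hα hv hv'
  obtain ⟨T₂, C₂, hC₂, h2⟩ := k.exists_abs_le_exp hp hq hα hw hw'
  set C := max C₁ C₂
  have hC : 0 ≤ C := hC₁.trans (le_max_left _ _)
  have hd : IsDecayingPerturbation p q (max T₁ T₂) (fun t => v t - w t) (fun t => v' t - w' t)
      (fun t => |v t| ^ α * v t - |w t| ^ α * w t) := by
    refine ⟨fun t _ => (h.left t).sub (k.left t), fun t _ => ?_, ?_, ?_⟩
    · exact ((h.right t).sub (k.right t)).congr_deriv (by ring)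
    · simpa using hv.sub hw
    · simpa using hv'.sub hw'
  -- `K e^{-δt}` is the Lipschitz constant `(α + 1) M^α` of the nonlinearity on `[-M, M]`, with `M =
  -- C e^{-qt/2}`.
  obtain ⟨L, hL, hL0⟩ := hd.exists_tendsto_exp_mul hp hq (K := (α + 1) * C ^ α)
    (δ := q / 2 * α) (by positivity) (by positivity) (fun t ht => by
      have hE := Real.exp_pos (-(q / 2) * t)
      refine (abs_nonlinearity_sub_le (M := C * Real.exp (-(q / 2) * t)) hα
        ((h1 t ((le_max_left _ _).trans ht)).trans (by gcongr; exact le_max_left _ _))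
        ((h2 t ((le_max_right _ _).trans ht)).trans (by gcongr; exact le_max_right _ _))).trans_eq ?_
      rw [Real.mul_rpow hC hE.le, ← Real.exp_mul]
      ring_nf)
  refine ⟨L, hL, fun h0 => ?_⟩
  obtain ⟨t₀, ht₀, ht₀'⟩ := hL0 h0
  exact h.eq_of_eq_at hα k (sub_eq_zero.1 ht₀) (sub_eq_zero.1 ht₀')

lemma IsTrajectory.exists_tendsto_exp_mul {p q α : ℝ} (hp : 0 < p) (hq : 0 < q) (hα : 0 < α)
    {v v' : ℝ → ℝ} (h : IsTrajectory p q α v v') (hv : Tendsto v atTop (𝓝 0))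
    (hv' : Tendsto v' atTop (𝓝 0)) :
    ∃ L, Tendsto (fun t => Real.exp (q * t) * v t) atTop (𝓝 L) ∧ (L = 0 → ∀ t, v t = 0) := by
  simpa using h.exists_tendsto_exp_mul_sub hp hq hα hv hv' (isTrajectory_zero p q α)
    tendsto_const_nhds tendsto_const_nhds

/-! ### Energy and long-time behaviour -/

lemma abs_rpow_add_two {α : ℝ} (hα : 0 < α) (x : ℝ) : |x| ^ (α + 2) = |x| ^ α * x ^ 2 := by
  rw [← sq_abs x, ← Real.rpow_natCast, ← Real.rpow_add_of_nonneg (abs_nonneg x) hα.le (by norm_num)]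
  norm_num

lemma isTrajectory_const {p q α l : ℝ} (hl : p * q * l - |l| ^ α * l = 0) :
    IsTrajectory p q α (fun _ => l) (fun _ => 0) where
  left t := hasDerivAt_const t l
  right t := (hasDerivAt_const t (0 : ℝ)).congr_deriv (by rw [mul_zero, zero_add, hl])

lemma exists_mul_sq_sub_le {α c : ℝ} (hα : 0 < α) (hc : 0 < c) :
    ∃ A, ∀ x : ℝ, c * x ^ 2 - |x| ^ (α + 2) / (α + 2) ≤ A := by
  -- Beyond `R` one has `|x|^α ≥ c (α + 2)`, and the superquadratic term absorbs `c x²`.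
  set R := (c * (α + 2)) ^ (1 / α) with hR
  have hR0 : 0 ≤ R := by positivity
  refine ⟨c * R ^ 2, fun x => ?_⟩
  rw [abs_rpow_add_two hα]
  rcases le_or_gt |x| R with hx | hx
  · have h1 : x ^ 2 ≤ R ^ 2 := by rw [← sq_abs]; gcongr
    have h2 : 0 ≤ |x| ^ α * x ^ 2 / (α + 2) := by positivity
    have h3 : c * x ^ 2 ≤ c * R ^ 2 := by gcongr
    linarith
  · have h1 : c * (α + 2) ≤ |x| ^ α := by
      calc c * (α + 2) = R ^ α := by
            rw [hR, one_div, Real.rpow_inv_rpow (by positivity) hα.ne']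
        _ ≤ |x| ^ α := by gcongr
    have h2 : c * x ^ 2 ≤ |x| ^ α * x ^ 2 / (α + 2) := by
      rw [le_div_iff₀ (by linarith)]
      nlinarith [sq_nonneg x]
    have h3 : 0 ≤ c * R ^ 2 := by positivity
    linarith

/-- The energy is coercive. -/
lemma exists_sq_le_energy {p q α : ℝ} (hp : 0 < p) (hq : 0 < q) (hα : 0 < α) :
    ∃ A, ∀ (v v' : ℝ → ℝ) (t : ℝ), v t ^ 2 + v' t ^ 2 / 2 ≤ trajEnergy p q α v v' t + A ∧
      v' t ^ 2 ≤ 2 * (trajEnergy p q α v v' t + A) := by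
  -- The `1` added to `p q / 2` leaves a full `v²` in the lower bound.
  obtain ⟨A, hA⟩ := exists_mul_sq_sub_le hα (c := p * q / 2 + 1) (by positivity)
  refine ⟨A, fun v v' t => ?_⟩
  have := hA (v t)
  unfold trajEnergy
  constructor <;> nlinarith [sq_nonneg (v t)]

lemma exists_bound_of_energy_le {p q α : ℝ} (hp : 0 < p) (hq : 0 < q) (hα : 0 < α) (B : ℝ) :
    ∃ M, ∀ (v v' : ℝ → ℝ) (t : ℝ), trajEnergy p q α v v' t ≤ B → |v t| ≤ M ∧ |v' t| ≤ M := by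
  obtain ⟨A, hA⟩ := exists_sq_le_energy hp hq hα
  refine ⟨√(2 * (|B| + |A|)), fun v v' t h => ?_⟩
  have h1 := hA v v' t
  have h2 := le_abs_self B
  have h3 := le_abs_self A
  constructor <;> apply Real.abs_le_sqrt <;> nlinarith [sq_nonneg (v t), sq_nonneg (v' t)]

lemma energy_neg {p q α : ℝ} (v v' : ℝ → ℝ) (t : ℝ) :
    trajEnergy p q α (fun t => -v t) (fun t => -v' t) t = trajEnergy p q α v v' t := by
  simp only [trajEnergy, abs_neg]; ring

/-- The energy of the equilibrium `l`. -/
noncomputable def potential (p q α l : ℝ) : ℝ := -(p * q * l ^ 2 / 2) + |l| ^ (α + 2) / (α + 2)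

lemma tendsto_energy {p q α l : ℝ} (hα : 0 < α) {v v' : ℝ → ℝ} {F : Filter ℝ}
    (hv : Tendsto v F (𝓝 l)) (hv' : Tendsto v' F (𝓝 0)) :
    Tendsto (trajEnergy p q α v v') F (𝓝 (potential p q α l)) := by
  have h1 := ((continuous_abs.rpow_const
    (fun _ => Or.inr (by linarith : 0 ≤ α + 2))).tendsto l).comp hv
  have := (((hv'.pow 2).div_const 2).sub (((hv.pow 2).const_mul (p * q)).div_const 2)).add
    (h1.div_const (α + 2))
  rw [show trajEnergy p q α v v' = fun x => v' x ^ 2 / 2 - p * q * v x ^ 2 / 2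
    + |v x| ^ (α + 2) / (α + 2) from rfl]
  simpa [potential, Function.comp_def] using this

/-- At an equilibrium `|l|^{α+2} = p q l²`, so its energy is `-p q l² (1/2 - 1/(α+2))`. -/
lemma potential_nonpos {p q α l : ℝ} (hp : 0 < p) (hq : 0 < q) (hα : 0 < α)
    (hl : p * q * l - |l| ^ α * l = 0) :
    potential p q α l ≤ 0 ∧ (l ≠ 0 → potential p q α l < 0) := by
  have h1 : potential p q α l = -(p * q * l ^ 2 * (1 / 2 - 1 / (α + 2))) := by
    have : |l| ^ α * l ^ 2 = p * q * l ^ 2 := by linear_combination (-l) * hl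
    rw [potential, abs_rpow_add_two hα, this]; ring
  have h2 : 0 < 1 / 2 - 1 / (α + 2) := by
    have := one_div_lt_one_div_of_lt (by norm_num : (0 : ℝ) < 2) (by linarith : 2 < α + 2)
    linarith
  rw [h1]
  refine ⟨by have : 0 ≤ p * q * l ^ 2 * (1 / 2 - 1 / (α + 2)) := by positivity
             linarith, fun hl0 => ?_⟩
  have : 0 < p * q * l ^ 2 * (1 / 2 - 1 / (α + 2)) := by positivity
  linarith

lemma potential_eq_of_ne_zero {p q α l l' : ℝ} (hp : 0 < p) (hq : 0 < q) (hα : 0 < α)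
    (hl : p * q * l - |l| ^ α * l = 0) (hl' : p * q * l' - |l'| ^ α * l' = 0)
    (h : l ≠ 0) (h' : l' ≠ 0) : potential p q α l = potential p q α l' := by
  have key : ∀ x : ℝ, p * q * x - |x| ^ α * x = 0 → x ≠ 0 → |x| = (p * q) ^ (1 / α) := by
    intro x hx hx0
    rcases (equilibrium_iff (mul_pos hp hq) hα).1 hx with h | h | h
    · exact absurd h hx0
    · rw [h, abs_of_nonneg (by positivity)]
    · rw [h, abs_neg, abs_of_nonneg (by positivity)]
  unfold potential
  rw [← sq_abs l, ← sq_abs l', key l hl h, key l' hl' h']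

/-- At a zero of `v` the energy reduces to `v'²/2`. Negative energy therefore keeps the sign of `v`
constant. -/
lemma ne_zero_of_energy_neg {p q α : ℝ} {v v' : ℝ → ℝ} (hα : 0 < α) {t : ℝ}
    (hE : trajEnergy p q α v v' t < 0) : v t ≠ 0 := by
  intro h0
  rw [trajEnergy, h0, abs_zero, Real.zero_rpow (by linarith)] at hE
  have := sq_nonneg (v' t)
  norm_num at hE
  linarith

namespace IsTrajectory

variable {p q α : ℝ} {v v' : ℝ → ℝ}

lemma energy_monotone (h : IsTrajectory p q α v v') (hqp : q < p) (hα : 0 < α) :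
    Monotone (trajEnergy p q α v v') := by
  rw [← monotoneOn_univ]
  exact monotoneOn_of_hasDerivAt convex_univ (fun t _ => h.hasDerivAt_energy hα t)
    (fun t _ => mul_nonneg (by linarith) (sq_nonneg _))

/-- If the energy stagnates on an interval, `v'` vanishes there, so `v` sits at an equilibrium and
is constant by uniqueness. -/
lemma energy_strictMono (h : IsTrajectory p q α v v') (hqp : q < p) (hα : 0 < α)
    (hne : ∀ l, ¬ ∀ t, v t = l) : StrictMono (trajEnergy p q α v v') := by
  intro s t hst
  refine lt_of_le_of_ne (h.energy_monotone hqp hα hst.le) fun heq => ?_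
  have hconst : ∀ x ∈ Ioo s t, trajEnergy p q α v v' x = trajEnergy p q α v v' s := fun x hx =>
    le_antisymm ((h.energy_monotone hqp hα hx.2.le).trans heq.ge)
      (h.energy_monotone hqp hα hx.1.le)
  have hv' : ∀ x ∈ Ioo s t, v' x = 0 := by
    intro x hx
    have h1 : HasDerivAt (trajEnergy p q α v v') 0 x :=
      (hasDerivAt_const x (trajEnergy p q α v v' s)).congr_of_eventuallyEq (by
        filter_upwards [Ioo_mem_nhds hx.1 hx.2] with y hy using hconst y hy)
    have h2 := (h.hasDerivAt_energy hα x).unique h1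
    rcases mul_eq_zero.1 h2 with h3 | h3
    · linarith
    · exact pow_eq_zero_iff (two_ne_zero) |>.1 h3
  set x := (s + t) / 2
  have hx : x ∈ Ioo s t := ⟨by simp only [x]; linarith, by simp only [x]; linarith⟩
  have h1 : HasDerivAt v' 0 x :=
    (hasDerivAt_const x (0 : ℝ)).congr_of_eventuallyEq (by
      filter_upwards [Ioo_mem_nhds hx.1 hx.2] with y hy using hv' y hy)
  have h2 := (h.right x).unique h1
  rw [hv' x hx, mul_zero, zero_add] at h2
  exact hne (v x) fun y => h.eq_of_eq_at hα (isTrajectory_const h2) rfl (hv' x hx) y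

/-- Coercivity gives `E' = (p - q) v'² ≤ 2 (p - q)(E + A)`, so `E + A` grows at most like
`e^{2(p-q)t}`. After division by `e^{pt}` this is the bound `r^{-q}` for `u`. -/
lemma exists_abs_le_exp_growth (h : IsTrajectory p q α v v') (hp : 0 < p) (hq : 0 < q)
    (hqp : q < p) (hα : 0 < α) : ∃ C, ∀ t ≥ 0, |v t| ≤ C * Real.exp ((p - q) * t) := by
  obtain ⟨A, hA⟩ := exists_sq_le_energy hp hq hα
  have hanti := antitoneOn_of_hasDerivAt (convex_Ici (0 : ℝ))
    (h := fun t => Real.exp (-(2 * (p - q)) * t) * (trajEnergy p q α v v' t + A))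
    (fun t _ => (((hasDerivAt_id t).const_mul (-(2 * (p - q)))).exp).mul
      ((h.hasDerivAt_energy hα t).add_const A)) (fun t _ => by
        have h1 := (hA v v' t).2
        have h2 := mul_nonneg (Real.exp_pos (-(2 * (p - q)) * t)).le
          (mul_nonneg (by linarith : 0 ≤ p - q) (by linarith :
            0 ≤ 2 * (trajEnergy p q α v v' t + A) - v' t ^ 2))
        simp only [id]
        nlinarith)
  refine ⟨√(trajEnergy p q α v v' 0 + A), fun t ht => ?_⟩
  have h0 : 0 ≤ trajEnergy p q α v v' 0 + A := by have := (hA v v' 0).2; nlinarith [sq_nonneg (v' 0)]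
  have h1 := hanti self_mem_Ici ht ht
  simp only [mul_zero, Real.exp_zero, one_mul] at h1
  refine abs_le_of_sq_le_sq ?_ (by positivity)
  rw [mul_pow, Real.sq_sqrt h0, ← Real.exp_nat_mul]
  have h2 : Real.exp (((2 : ℕ) : ℝ) * ((p - q) * t)) * Real.exp (-(2 * (p - q)) * t) = 1 := by
    rw [← Real.exp_add]; push_cast; ring_nf; exact Real.exp_zero
  calc v t ^ 2 ≤ trajEnergy p q α v v' t + A := by
        have := (hA v v' t).1; nlinarith [sq_nonneg (v' t)]
    _ = Real.exp (((2 : ℕ) : ℝ) * ((p - q) * t)) *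
        (Real.exp (-(2 * (p - q)) * t) * (trajEnergy p q α v v' t + A)) := by
      rw [← mul_assoc, h2, one_mul]
    _ ≤ Real.exp (((2 : ℕ) : ℝ) * ((p - q) * t)) * (trajEnergy p q α v v' 0 + A) := by gcongr
    _ = _ := mul_comm _ _

/-- The energy increases with time, so coercivity bounds the trajectory on every left half-line; the
reversed trajectory then converges. -/
lemma exists_tendsto_atBot (h : IsTrajectory p q α v v') (hp : 0 < p) (hq : 0 < q)
    (hqp : q < p) (hα : 0 < α) :
    Tendsto v' atBot (𝓝 0) ∧ ∃ l, p * q * l - |l| ^ α * l = 0 ∧ Tendsto v atBot (𝓝 l) := by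
  obtain ⟨M, hM⟩ := exists_bound_of_energy_le hp hq hα (trajEnergy p q α v v' 0)
  have hb : ∀ t ≥ 0, |v (-t)| ≤ M ∧ |v' (-t)| ≤ M := fun t ht =>
    hM v v' (-t) (h.energy_monotone hqp hα (by linarith))
  obtain ⟨h1, l, hl, h2⟩ := h.reverse.exists_tendsto_of_bounded hq hp hqp.ne hα
    (T := 0) (M := M) (fun t ht => (hb t ht).1) (fun t ht => by
      rw [abs_neg]; exact (hb t ht).2)
  refine ⟨?_, l, by rw [← hl]; ring, ?_⟩
  · have := (h1.comp tendsto_neg_atBot_atTop).neg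
    simpa [Function.comp_def] using this
  · have := h2.comp tendsto_neg_atBot_atTop
    simpa [Function.comp_def] using this

/-- A trajectory which is positive near infinity has bounded derivatives and converges. -/
lemma exists_tendsto_of_eventually_pos (h : IsTrajectory p q α v v') (hp : 0 < p) (hq : 0 < q)
    (hqp : q < p) (hα : 0 < α) {T : ℝ} (hpos : ∀ t ≥ T, 0 < v t) :
    Tendsto v' atTop (𝓝 0) ∧ ∃ l, p * q * l - |l| ^ α * l = 0 ∧ Tendsto v atTop (𝓝 l) := by
  -- While `v > 0` the nonlinearity has a sign, so `e^{qt}(v' - p v)` and `e^{-pt}(v' + q v)` are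
  -- both nonincreasing. They control `v'/v` from above and from below.
  have hy : ∀ t, HasDerivAt (fun t => Real.exp (q * t) * (v' t - p * v t))
      (-(Real.exp (q * t) * (|v t| ^ α * v t))) t := fun t => by
    refine ((((hasDerivAt_id t).const_mul q).exp).mul
      ((h.right t).sub ((h.left t).const_mul p))).congr_deriv ?_
    simp only [id, Pi.sub_apply]; ring
  have hz : ∀ t, HasDerivAt (fun t => Real.exp (-p * t) * (v' t + q * v t))
      (-(Real.exp (-p * t) * (|v t| ^ α * v t))) t := fun t => by
    refine ((((hasDerivAt_id t).const_mul (-p)).exp).mul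
      ((h.right t).add ((h.left t).const_mul q))).congr_deriv ?_
    simp only [id, Pi.add_apply]; ring
  have hf : ∀ t ≥ T, 0 ≤ |v t| ^ α * v t := fun t ht => by have := hpos t ht; positivity
  have hyanti := antitoneOn_of_hasDerivAt (convex_Ici T) (fun t _ => hy t)
    (fun t ht => by have := mul_nonneg (Real.exp_pos (q * t)).le (hf t ht); linarith)
  have hzanti := antitoneOn_of_hasDerivAt (convex_Ici T) (fun t _ => hz t)
    (fun t ht => by have := mul_nonneg (Real.exp_pos (-p * t)).le (hf t ht); linarith)
  -- lower bound for the logarithmic derivative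
  have hlow : ∀ t ≥ T, -(q * v t) ≤ v' t := by
    intro t₁ ht₁
    -- If `v' + q v = c < 0` at some time, then `v' ≤ c` ever after and `v` becomes nonpositive in
    -- finite time.
    by_contra hc
    push Not at hc
    set c := v' t₁ + q * v t₁ with hcdef
    have hc0 : c < 0 := by linarith
    have h1 : ∀ t ≥ t₁, v' t ≤ c := by
      intro t ht
      have h2 := hzanti ht₁ (ht₁.le.trans ht) ht
      simp only [← hcdef] at h2
      have h3 : Real.exp (-p * t) ≤ Real.exp (-p * t₁) := by
        apply Real.exp_le_exp.2; nlinarith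
      have h4 : Real.exp (-p * t) * (v' t + q * v t) ≤ Real.exp (-p * t) * c :=
        h2.trans (mul_le_mul_of_nonpos_right h3 hc0.le)
      have h5 := le_of_mul_le_mul_left h4 (Real.exp_pos _)
      have := mul_pos hq (hpos t (ht₁.le.trans ht))
      linarith
    have h2 := antitoneOn_of_hasDerivAt (convex_Ici t₁) (h := fun t => v t - c * t)
      (fun t _ => (h.left t).sub ((hasDerivAt_id t).const_mul c))
      (fun t ht => by have := h1 t ht; linarith)
    have hs : t₁ ≤ t₁ + v t₁ / (-c) := by
      have := hpos t₁ ht₁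
      have : 0 ≤ v t₁ / (-c) := div_nonneg this.le (by linarith)
      linarith
    have h3 := h2 self_mem_Ici hs hs
    have h4 := hpos _ (ht₁.le.trans hs)
    have h5 : c * (v t₁ / (-c)) = - v t₁ := by
      have := hc0.ne
      rw [div_neg, mul_neg, mul_div_cancel₀ _ this]
    simp only [mul_add, h5] at h3
    linarith
  -- upper bound for the logarithmic derivative
  obtain ⟨S, hTS, hup⟩ : ∃ S, T ≤ S ∧ ∀ t ≥ S, v' t < p * v t := by
    by_contra hcon
    push Not at hcon
    -- If `v' ≥ p v` recurs, monotonicity makes it hold throughout. Then `v` increases and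
    -- `e^{qt}(v' - p v)` falls at speed at least `c > 0`, so it becomes negative after time `(D +
    -- 1)/c`.
    have h1 : ∀ t ≥ T, p * v t ≤ v' t := by
      intro t ht
      obtain ⟨s, hs, hs'⟩ := hcon t ht
      have h2 := hyanti ht (ht.le.trans hs) hs
      have h3 : 0 ≤ Real.exp (q * s) * (v' s - p * v s) :=
        mul_nonneg (Real.exp_pos _).le (by linarith)
      have h4 := nonneg_of_mul_nonneg_right (h3.trans h2) (Real.exp_pos _)
      linarith
    have hvm := monotoneOn_of_hasDerivAt (convex_Ici T) (fun t _ => h.left t)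
      (fun t ht => by have := h1 t ht; have := mul_pos hp (hpos t ht); linarith)
    set c := Real.exp (q * T) * (|v T| ^ α * v T) with hc
    have hvT := hpos T le_rfl
    have hc0 : 0 < c := by positivity
    have h2 := antitoneOn_of_hasDerivAt (convex_Ici T)
      (h := fun t => Real.exp (q * t) * (v' t - p * v t) + c * t)
      (fun t _ => (hy t).add ((hasDerivAt_id t).const_mul c)) (fun t ht => by
        have h3 : v T ≤ v t := hvm self_mem_Ici ht ht
        have h4 : c ≤ Real.exp (q * t) * (|v t| ^ α * v t) := by
          rw [hc, abs_of_pos hvT, abs_of_pos (hpos t ht)]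
          have : T ≤ t := ht
          have hvt := (hpos t ht).le
          gcongr
        linarith)
    set D := Real.exp (q * T) * (v' T - p * v T) with hD
    have hD0 : 0 ≤ D := mul_nonneg (Real.exp_pos _).le (by linarith [h1 T le_rfl])
    have hs : T ≤ T + (D + 1) / c := by
      have : 0 ≤ (D + 1) / c := by positivity
      linarith
    have h3 := h2 self_mem_Ici hs hs
    have h4 : 0 ≤ Real.exp (q * (T + (D + 1) / c)) * (v' (T + (D + 1) / c) - p * v (T + (D + 1) / c)) :=
      mul_nonneg (Real.exp_pos _).le (by linarith [h1 _ hs])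
    have h5 : c * (T + (D + 1) / c) = c * T + (D + 1) := by field_simp
    simp only [h5] at h3
    linarith
  -- boundedness
  set G := (p + q) ^ 2 / 4 + p with hG
  set R := Real.exp p * G ^ (1 / α) with hR
  -- Since `v' < p v`, `v` grows by at most `e^p` per unit time, so `v t ≥ R` forces `v^α ≥ G` on
  -- `[t-1, t]`. The Riccati equation for `v'/v` then gives slope at most `-p` there; starting below
  -- `p`, the quotient is negative after one unit of time.
  have hkey : ∀ t ≥ S + 1, R ≤ v t → v' t < 0 := by
    intro t ht hRt
    have hvt := hpos t (by linarith)
    have hpa := antitoneOn_of_hasDerivAt (convex_Ici S) (h := fun t => Real.exp (-p * t) * v t)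
      (fun t _ => (((hasDerivAt_id t).const_mul (-p)).exp).mul (h.left t)) (fun s hs => by
        have h1 := mul_nonneg (Real.exp_pos (-p * s)).le (by linarith [hup s hs] :
          0 ≤ p * v s - v' s)
        simp only [id]; linarith)
    have h1 : ∀ s ∈ Icc (t - 1) t, G ≤ v s ^ α := by
      intro s hs
      have hvs := hpos s (by linarith [hs.1])
      have h2 := hpa (show S ≤ s by linarith [hs.1]) (show S ≤ t by linarith) hs.2
      simp only at h2
      have h3 : Real.exp (-p) * v t ≤ v s := by
        have h4 : v s = Real.exp (p * s) * (Real.exp (-p * s) * v s) := by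
          rw [← mul_assoc, ← Real.exp_add]; ring_nf; simp
        rw [h4]
        calc Real.exp (-p) * v t ≤ Real.exp (p * s - p * t) * v t := by
              gcongr; nlinarith [hs.1]
          _ = Real.exp (p * s) * (Real.exp (-p * t) * v t) := by
              rw [← mul_assoc, ← Real.exp_add]; ring_nf
          _ ≤ _ := by gcongr
      have h5 : G ^ (1 / α) ≤ v s := by
        refine le_trans ?_ h3
        calc G ^ (1 / α) = Real.exp (-p) * R := by
              rw [hR, ← mul_assoc, ← Real.exp_add]; simp
          _ ≤ _ := by gcongr
      calc G = (G ^ (1 / α)) ^ α := by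
            rw [one_div, Real.rpow_inv_rpow (by positivity) hα.ne']
        _ ≤ v s ^ α := by gcongr
    have h2 := antitoneOn_of_hasDerivAt (convex_Icc (t - 1) t)
      (h := fun s => v' s / v s + p * s)
      (fun s hs => ((h.right s).div (h.left s) (hpos s (by linarith [hs.1])).ne').add
        ((hasDerivAt_id s).const_mul p)) (fun s hs => by
        have hvs := hpos s (by linarith [hs.1])
        have h3 := h1 s hs
        have h4 : (((p - q) * v' s + p * q * v s - |v s| ^ α * v s) * v s - v' s * v' s) / v s ^ 2
            = (p + q) ^ 2 / 4 - v s ^ α - (v' s / v s - (p - q) / 2) ^ 2 := by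
          rw [abs_of_pos hvs]; field_simp; ring
        rw [h4]
        nlinarith [sq_nonneg (v' s / v s - (p - q) / 2)])
    have h3 := h2 (left_mem_Icc.2 (by linarith)) (right_mem_Icc.2 (by linarith))
      (by linarith : t - 1 ≤ t)
    have h4 : v' (t - 1) / v (t - 1) < p := by
      rw [div_lt_iff₀ (hpos _ (by linarith))]; exact hup _ (by linarith)
    simp only at h3
    have h5 : v' t / v t < 0 := by linarith
    by_contra hc
    push Not at hc
    have := div_nonneg hc hvt.le
    linarith
  set B := max (v (S + 1)) R with hB
  have hvB : ∀ t ≥ S + 1, v t ≤ B := by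
    intro t ht
    -- The level `B ≥ R` cannot be crossed upward, because `v' < 0` whenever `v = B`.
    refine image_le_of_deriv_right_lt_deriv_boundary (f := v) (f' := v') (a := S + 1) (b := t)
      (B := fun _ => B) (B' := fun _ => 0) h.continuous_left.continuousOn
      (fun s _ => (h.left s).hasDerivWithinAt) (le_max_left _ _) (fun s => hasDerivAt_const s B)
      (fun s hs hsB => hkey s hs.1 ?_) (right_mem_Icc.2 ht)
    rw [hsB]; exact le_max_right _ _
  have hB0 : 0 < B := (hpos _ (by linarith)).trans_le (hvB (S + 1) le_rfl)
  refine h.exists_tendsto_of_bounded hp hq hqp.ne' hα (T := S + 1) (M := max B (p * B))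
    (fun t ht => ?_) (fun t ht => ?_)
  · rw [abs_of_pos (hpos t (by linarith))]; exact (hvB t ht).trans (le_max_left _ _)
  · refine le_trans (abs_le.2 ⟨?_, ?_⟩) (le_max_right _ _)
    · have h1 := hlow t (by linarith)
      have h2 : q * v t ≤ p * B := mul_le_mul hqp.le (hvB t ht) (hpos t (by linarith)).le hp.le
      linarith
    · have h1 := hup t (by linarith)
      have h2 : p * v t ≤ p * B := by gcongr; exact hvB t ht
      linarith

/-- Otherwise `v ≥ 0` eventually. A zero would be a minimum, with `v = v' = 0` and zero energy; so
`v > 0`, and `v` converges to an equilibrium. Its energy is at most `0`, yet it is the limit of an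
increasing positive function. -/
lemma frequently_neg_of_energy_pos (h : IsTrajectory p q α v v') (hp : 0 < p) (hq : 0 < q)
    (hqp : q < p) (hα : 0 < α) {t₀ : ℝ} (hE : 0 < trajEnergy p q α v v' t₀) :
    ∃ᶠ t in atTop, v t < 0 := by
  intro hcon
  obtain ⟨T, hT⟩ := eventually_atTop.1 (hcon.and (eventually_ge_atTop t₀))
  have hEpos : ∀ t ≥ T, 0 < trajEnergy p q α v v' t := fun t ht =>
    hE.trans_le (h.energy_monotone hqp hα (hT t ht).2)
  have hnn : ∀ t ≥ T, 0 ≤ v t := fun t ht => not_lt.1 (hT t ht).1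
  -- The shift from `T` to `T + 1` puts `t` in the interior of `[T, ∞)`, so that a zero is a
  -- two-sided local minimum.
  have hpos : ∀ t ≥ T + 1, 0 < v t := by
    intro t ht
    refine lt_of_le_of_ne (hnn t (by linarith)) fun h0 => ?_
    have hmin : IsLocalMin v t := by
      filter_upwards [Ioi_mem_nhds (show T < t by linarith)] with s hs
      rw [← h0]; exact hnn s (le_of_lt hs)
    have h1 := hmin.hasDerivAt_eq_zero (h.left t)
    have h2 := hEpos t (by linarith)
    rw [trajEnergy, h1, ← h0, abs_zero, Real.zero_rpow (by linarith)] at h2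
    norm_num at h2
  obtain ⟨h1, l, hl, h2⟩ := h.exists_tendsto_of_eventually_pos hp hq hqp hα hpos
  have h3 := tendsto_energy (p := p) (q := q) hα h2 h1
  have h4 := (potential_nonpos hp hq hα hl).1
  have h5 : trajEnergy p q α v v' T ≤ potential p q α l :=
    ge_of_tendsto h3 (by
      filter_upwards [eventually_ge_atTop T] with t ht using h.energy_monotone hqp hα ht)
  linarith [hEpos T le_rfl]

lemma frequently_pos_of_energy_pos (h : IsTrajectory p q α v v') (hp : 0 < p) (hq : 0 < q)
    (hqp : q < p) (hα : 0 < α) {t₀ : ℝ} (hE : 0 < trajEnergy p q α v v' t₀) :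
    ∃ᶠ t in atTop, 0 < v t := by
  have := h.neg.frequently_neg_of_energy_pos hp hq hqp hα (t₀ := t₀) (by rwa [energy_neg])
  simpa using this

/-- The energy of a nontrivial trajectory emanating from the origin is positive. -/
lemma energy_pos_of_tendsto_zero (h : IsTrajectory p q α v v') (hqp : q < p) (hα : 0 < α)
    (hne : ∃ t, v t ≠ 0) (hv : Tendsto v atBot (𝓝 0)) (hv' : Tendsto v' atBot (𝓝 0)) (t : ℝ) :
    0 < trajEnergy p q α v v' t := by
  have hs := h.energy_strictMono hqp hα (by
    intro l hl
    obtain ⟨s, hs⟩ := hne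
    have : Tendsto v atBot (𝓝 l) := tendsto_const_nhds.congr fun t => (hl t).symm
    exact hs ((hl s).trans (tendsto_nhds_unique this hv)))
  have h1 : potential p q α 0 ≤ trajEnergy p q α v v' (t - 1) :=
    le_of_tendsto (tendsto_energy hα hv hv') (by
      filter_upwards [eventually_le_atBot (t - 1)] with s hs' using hs.monotone hs')
  have h2 : potential p q α 0 = 0 := by
    simp [potential, Real.zero_rpow (by linarith : α + 2 ≠ 0)]
  have := hs (show t - 1 < t by linarith)
  linarith

/-- A nonzero constant trajectory has negative energy, so this one is not constant and its energy
increases strictly. -/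
lemma exists_energy_pos_of_energy_eq_zero (h : IsTrajectory p q α v v') (hp : 0 < p) (hq : 0 < q)
    (hqp : q < p) (hα : 0 < α) (hne : ∃ t, v t ≠ 0) {t₀ : ℝ}
    (hE : trajEnergy p q α v v' t₀ = 0) : 0 < trajEnergy p q α v v' (t₀ + 1) := by
  have hs := h.energy_strictMono hqp hα (by
    intro l hl
    obtain ⟨s, hs⟩ := hne
    have hl0 : l ≠ 0 := by rw [← hl s]; exact hs
    have hv : v = fun _ => l := funext hl
    have hv' : ∀ t, v' t = 0 := fun t => (h.left t).unique (by rw [hv]; exact hasDerivAt_const t l)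
    have h1 : HasDerivAt v' 0 t₀ := by rw [funext hv']; exact hasDerivAt_const t₀ 0
    have h2 := (h.right t₀).unique h1
    rw [hv' t₀, hl t₀, mul_zero, zero_add] at h2
    have h3 := (potential_nonpos hp hq hα h2).2 hl0
    rw [trajEnergy, hv' t₀, hl t₀] at hE
    rw [potential] at h3
    norm_num at hE
    linarith)
  rw [← hE]; exact hs (by linarith)

/-- A trajectory of negative energy is an equilibrium or converges to the origin at infinity. -/
lemma eq_const_or_tendsto_zero_of_energy_neg (h : IsTrajectory p q α v v') (hp : 0 < p)
    (hq : 0 < q) (hqp : q < p) (hα : 0 < α) (hE : ∀ t, trajEnergy p q α v v' t ≤ 0) {l₀ : ℝ}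
    (hl₀ : l₀ ≠ 0) (hv : Tendsto v atBot (𝓝 l₀)) :
    (∀ t, v t = l₀) ∨ (Tendsto v atTop (𝓝 0) ∧ Tendsto v' atTop (𝓝 0)) := by
  obtain ⟨M, hM⟩ := exists_bound_of_energy_le hp hq hα 0
  obtain ⟨h1, l, hl, h2⟩ := h.exists_tendsto_of_bounded hp hq hqp.ne' hα (T := 0) (M := M)
    (fun t _ => (hM v v' t (hE t)).1) (fun t _ => (hM v v' t (hE t)).2)
  by_cases hl0 : l = 0
  · right; rw [hl0] at h2; exact ⟨h2, h1⟩
  left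
  obtain ⟨h3, l', hl', h4⟩ := h.exists_tendsto_atBot hp hq hqp hα
  obtain rfl := tendsto_nhds_unique h4 hv
  -- The nonzero equilibria at the two ends have equal energy, which excludes a strictly increasing
  -- energy in between.
  have hconst : ∃ c, ∀ t, v t = c := by
    by_contra hne
    push Not at hne
    have hs := h.energy_strictMono hqp hα (fun c hc => (hne c).elim fun t ht => ht (hc t))
    have h5 : potential p q α l' ≤ trajEnergy p q α v v' 0 :=
      le_of_tendsto (tendsto_energy hα hv h3) (by
        filter_upwards [eventually_le_atBot 0] with s hs' using hs.monotone hs')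
    have h6 : trajEnergy p q α v v' 1 ≤ potential p q α l :=
      ge_of_tendsto (tendsto_energy hα h2 h1) (by
        filter_upwards [eventually_ge_atTop 1] with s hs' using hs.monotone hs')
    rw [potential_eq_of_ne_zero hp hq hα hl hl' hl0 hl₀] at h6
    have := hs (zero_lt_one)
    linarith
  obtain ⟨c, hc⟩ := hconst
  have : Tendsto v atBot (𝓝 c) := tendsto_const_nhds.congr fun t => (hc t).symm
  obtain rfl := tendsto_nhds_unique this hv
  exact hc

end IsTrajectory

/-! ### Emden–Fowler variables -/

/-- The exponent `N - 2 - 2/α` of decay at infinity. -/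
noncomputable def decayExp (N : ℕ) (α : ℝ) : ℝ := (N : ℝ) - 2 - 2 / α

/-- The lower bound on `α` amounts to `q > 0`, the upper (subcritical) bound to `q < p`. -/
lemma exponents_pos {N : ℕ} (hN : 3 ≤ N) {α : ℝ} (hα₁ : 2 / ((N : ℝ) - 2) < α)
    (hα₂ : α < 4 / ((N : ℝ) - 2)) :
    0 < α ∧ 0 < 2 / α ∧ 0 < decayExp N α ∧ decayExp N α < 2 / α := by
  have hN' : (3 : ℝ) ≤ N := by exact_mod_cast hN
  have hN2 : 0 < (N : ℝ) - 2 := by linarith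
  have hα : 0 < α := lt_trans (by positivity) hα₁
  have h1 : 2 / α < (N : ℝ) - 2 := by
    rw [div_lt_iff₀ hN2] at hα₁
    rw [div_lt_iff₀ hα]; linarith
  have h2 : (N : ℝ) - 2 < 2 * (2 / α) := by
    rw [lt_div_iff₀ hN2] at hα₂
    rw [mul_div_assoc', lt_div_iff₀ hα]; linarith
  refine ⟨hα, by positivity, ?_, ?_⟩ <;> unfold decayExp <;> linarith

lemma IsSolution.hasDerivAt {N : ℕ} {α : ℝ} {u : ℝ → ℝ} (hu : IsSolution N α u) {r : ℝ}
    (hr : 0 < r) : HasDerivAt u (deriv u r) r :=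
  ((hu.1.differentiableOn (by norm_num)).differentiableAt (Ioi_mem_nhds hr)).hasDerivAt

lemma IsSolution.contDiffOn_deriv {N : ℕ} {α : ℝ} {u : ℝ → ℝ} (hu : IsSolution N α u) :
    ContDiffOn ℝ 1 (deriv u) (Ioi 0) :=
  ((contDiffOn_succ_iff_deriv_of_isOpen (n := 1) isOpen_Ioi).1
    (by simpa [one_add_one_eq_two] using hu.1)).2.2

lemma IsSolution.hasDerivAt_deriv {N : ℕ} {α : ℝ} {u : ℝ → ℝ} (hu : IsSolution N α u) {r : ℝ}
    (hr : 0 < r) : HasDerivAt (deriv u) (deriv (deriv u) r) r :=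
  ((hu.contDiffOn_deriv.differentiableOn (by norm_num)).differentiableAt
    (Ioi_mem_nhds hr)).hasDerivAt

lemma IsSolution.neg {N : ℕ} {α : ℝ} {u : ℝ → ℝ} (hu : IsSolution N α u) :
    IsSolution N α (fun r => -u r) := by
  refine ⟨hu.1.neg, fun r hr => ?_⟩
  have h1 : deriv (fun r => -u r) = fun r => -deriv u r := by
    ext r; exact deriv.fun_neg
  rw [h1, deriv.fun_neg, abs_neg]
  have := hu.2 r hr
  linear_combination -this

/-- The Emden–Fowler transform `e^{p t} u(e^t)`. -/
noncomputable def emden (p : ℝ) (u : ℝ → ℝ) (t : ℝ) : ℝ := Real.exp (p * t) * u (Real.exp t)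

/-- The derivative of the Emden–Fowler transform. -/
noncomputable def emdenDeriv (p : ℝ) (u : ℝ → ℝ) (t : ℝ) : ℝ :=
  Real.exp (p * t) * (p * u (Real.exp t) + Real.exp t * deriv u (Real.exp t))

lemma IsSolution.isTrajectory {N : ℕ} {α : ℝ} (hα : 0 < α) {u : ℝ → ℝ} (hu : IsSolution N α u) :
    IsTrajectory (2 / α) (decayExp N α) α (emden (2 / α) u) (emdenDeriv (2 / α) u) where
  left t := by
    have h1 := ((hasDerivAt_id t).const_mul (2 / α)).exp
    have h2 := (hu.hasDerivAt (Real.exp_pos t)).comp t (Real.hasDerivAt_exp t)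
    refine (h1.mul h2).congr_deriv ?_
    simp only [emdenDeriv, id, Function.comp]; ring
  right t := by
    have h1 := ((hasDerivAt_id t).const_mul (2 / α)).exp
    have h2 := (hu.hasDerivAt (Real.exp_pos t)).comp t (Real.hasDerivAt_exp t)
    have h3 := (hu.hasDerivAt_deriv (Real.exp_pos t)).comp t (Real.hasDerivAt_exp t)
    have h4 := h1.mul ((h2.const_mul (2 / α)).add ((Real.hasDerivAt_exp t).mul h3))
    refine h4.congr_deriv ?_
    have h5 := hu.2 _ (Real.exp_pos t)
    have hE := Real.exp_pos t
    set r := Real.exp t with hr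
    -- The choice `p = 2/α` gives `e^{pαt} = r²`, which makes the transformed equation autonomous.
    have h6 : |emden (2 / α) u t| ^ α * emden (2 / α) u t
        = Real.exp (2 / α * t) * (r ^ 2 * (|u r| ^ α * u r)) := by
      have : Real.exp (2 / α * t) ^ α = r ^ 2 := by
        rw [← Real.exp_mul, hr, ← Real.exp_nat_mul]
        congr 1; field_simp; norm_num; ring
      rw [emden, abs_mul, abs_of_pos (Real.exp_pos _), Real.mul_rpow (Real.exp_pos _).le
        (abs_nonneg _), this, ← hr]
      ring
    have h7 : r ^ 2 * deriv (deriv u) r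
        = -(((N : ℝ) - 1) * r * deriv u r) - r ^ 2 * (|u r| ^ α * u r) := by
      field_simp at h5
      linear_combination r * h5
    rw [h6]
    simp only [emdenDeriv, emden, id, Function.comp, Pi.add_apply, Pi.mul_apply, ← hr, decayExp]
    linear_combination Real.exp (2 / α * t) * h7

lemma rpow_mul_eq_emden {p : ℝ} (u : ℝ → ℝ) {r : ℝ} (hr : 0 < r) :
    r ^ p * u r = emden p u (Real.log r) := by
  rw [emden, Real.exp_log hr, Real.rpow_def_of_pos hr, mul_comm (Real.log r)]

lemma rpow_mul_deriv_eq_emdenDeriv {p : ℝ} (u : ℝ → ℝ) {r : ℝ} (hr : 0 < r) :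
    r ^ (p + 1) * deriv u r = emdenDeriv p u (Real.log r) - p * emden p u (Real.log r) := by
  rw [emden, emdenDeriv, Real.exp_log hr, Real.rpow_add_one hr.ne', Real.rpow_def_of_pos hr,
    mul_comm (Real.log r)]
  ring

lemma emden_neg (p : ℝ) (u : ℝ → ℝ) (t : ℝ) : emden p (fun r => -u r) t = -emden p u t := by
  simp [emden]

/-- The positive factor `e^{2pt}` leaves the zeros unchanged, so (iii) becomes a statement about
zeros of the autonomous energy. -/
lemma energy_eq_trajEnergy {N : ℕ} {α : ℝ} (hα : 0 < α) (u : ℝ → ℝ) (t : ℝ) :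
    trajEnergy (2 / α) (decayExp N α) α (emden (2 / α) u) (emdenDeriv (2 / α) u) t
      = Real.exp (2 / α * t) ^ 2 * energy N α u (Real.exp t) := by
  have h1 : |emden (2 / α) u t| ^ (α + 2)
      = Real.exp (2 / α * t) ^ 2 * (Real.exp t ^ 2 * |u (Real.exp t)| ^ (α + 2)) := by
    have h2 : Real.exp (2 / α * t) ^ (α + 2) = Real.exp t ^ 2 * Real.exp (2 / α * t) ^ 2 := by
      rw [← Real.exp_mul, ← Real.exp_nat_mul, ← Real.exp_nat_mul, ← Real.exp_add]
      congr 1; field_simp; norm_num; ring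
    rw [emden, abs_mul, abs_of_pos (Real.exp_pos _), Real.mul_rpow (Real.exp_pos _).le
        (abs_nonneg _), h2]
    ring
  rw [trajEnergy, h1, energy, emden, emdenDeriv, sq_abs, sq_abs, decayExp]
  field_simp
  ring

lemma energy_eq_zero_iff {N : ℕ} {α : ℝ} (hα : 0 < α) (u : ℝ → ℝ) :
    (∃ r₀ : ℝ, 0 < r₀ ∧ energy N α u r₀ = 0) ↔ ∃ t, trajEnergy (2 / α) (decayExp N α) α
      (emden (2 / α) u) (emdenDeriv (2 / α) u) t = 0 := by
  constructor
  · rintro ⟨r, hr, h⟩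
    exact ⟨Real.log r, by rw [energy_eq_trajEnergy hα, Real.exp_log hr, h, mul_zero]⟩
  · rintro ⟨t, h⟩
    rw [energy_eq_trajEnergy hα] at h
    exact ⟨Real.exp t, Real.exp_pos t, by simpa using h⟩

lemma emden_pos_iff {p : ℝ} {u : ℝ → ℝ} {t : ℝ} : 0 < emden p u t ↔ 0 < u (Real.exp t) := by
  rw [emden]; exact mul_pos_iff_of_pos_left (Real.exp_pos _)

lemma emden_neg_iff {p : ℝ} {u : ℝ → ℝ} {t : ℝ} : emden p u t < 0 ↔ u (Real.exp t) < 0 := by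
  rw [emden]
  constructor
  · intro h; by_contra hc; push Not at hc
    have := mul_nonneg (Real.exp_pos (p * t)).le hc
    linarith
  · exact mul_neg_of_pos_of_neg (Real.exp_pos _)

lemma oscillates_of_emden {p : ℝ} {u : ℝ → ℝ} (h1 : ∃ᶠ t in atTop, 0 < emden p u t)
    (h2 : ∃ᶠ t in atTop, emden p u t < 0) : OscillatesAtInfinity u :=
  ⟨Real.tendsto_exp_atTop.frequently (h1.mono fun _ h => emden_pos_iff.1 h),
    Real.tendsto_exp_atTop.frequently (h2.mono fun _ h => emden_neg_iff.1 h)⟩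

lemma OscillatesAtInfinity.isSignChanging {u : ℝ → ℝ} (h : OscillatesAtInfinity u) :
    IsSignChanging u := by
  obtain ⟨r, hr, hr0⟩ := (h.1.and_eventually (eventually_gt_atTop 0)).exists
  obtain ⟨s, hs, hs0⟩ := (h.2.and_eventually (eventually_gt_atTop 0)).exists
  exact ⟨⟨r, hr0, hr⟩, ⟨s, hs0, hs⟩⟩

lemma tendsto_rpow_mul_of_emden {p l : ℝ} {u : ℝ → ℝ} (h : Tendsto (emden p u) atBot (𝓝 l)) :
    Tendsto (fun r : ℝ => r ^ p * u r) (𝓝[>] 0) (𝓝 l) := by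
  refine (h.comp Real.tendsto_log_nhdsGT_zero).congr' ?_
  filter_upwards [self_mem_nhdsWithin] with r hr
  exact (rpow_mul_eq_emden u hr).symm

lemma tendsto_emden_of_rpow_mul {p l : ℝ} {u : ℝ → ℝ}
    (h : Tendsto (fun r : ℝ => r ^ p * u r) (𝓝[>] 0) (𝓝 l)) :
    Tendsto (emden p u) atBot (𝓝 l) := by
  refine (h.comp Real.tendsto_exp_atBot_nhdsGT).congr fun t => ?_
  simp only [Function.comp]
  rw [rpow_mul_eq_emden u (Real.exp_pos t), Real.log_exp]

lemma tendsto_rpow_mul_deriv_of_emden {p l : ℝ} {u : ℝ → ℝ}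
    (h : Tendsto (emden p u) atBot (𝓝 l)) (h' : Tendsto (emdenDeriv p u) atBot (𝓝 0)) :
    Tendsto (fun r : ℝ => r ^ (p + 1) * deriv u r) (𝓝[>] 0) (𝓝 (-(p * l))) := by
  have h1 := (h'.sub (h.const_mul p)).comp Real.tendsto_log_nhdsGT_zero
  rw [zero_sub] at h1
  refine h1.congr' ?_
  filter_upwards [self_mem_nhdsWithin] with r hr
  exact (rpow_mul_deriv_eq_emdenDeriv u hr).symm

lemma tendsto_emden_zero_of_tendsto {p l : ℝ} (hp : 0 < p) {u : ℝ → ℝ}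
    (h : Tendsto u (𝓝[>] 0) (𝓝 l)) : Tendsto (emden p u) atBot (𝓝 0) := by
  apply tendsto_emden_of_rpow_mul
  have h1 : Tendsto (fun r : ℝ => r ^ p) (𝓝[>] 0) (𝓝 0) := by
    have := (Real.continuousAt_rpow_const 0 p (Or.inr hp.le)).tendsto
    rw [Real.zero_rpow hp.ne'] at this
    exact this.mono_left nhdsWithin_le_nhds
  simpa using h1.mul h

lemma tendsto_atTop_emden {p q l : ℝ} {u : ℝ → ℝ} :
    Tendsto (fun t => Real.exp (q * t) * emden p u t) atTop (𝓝 l) ↔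
      Tendsto (fun r : ℝ => r ^ (p + q) * u r) atTop (𝓝 l) := by
  have key : ∀ t, Real.exp (q * t) * emden p u t = Real.exp t ^ (p + q) * u (Real.exp t) := by
    intro t
    rw [emden, ← mul_assoc, ← Real.exp_add, ← Real.exp_mul]; ring_nf
  constructor
  · intro h
    refine (h.comp Real.tendsto_log_atTop).congr' ?_
    filter_upwards [eventually_gt_atTop 0] with r hr
    simp only [Function.comp, key, Real.exp_log hr]
  · intro h
    exact (h.comp Real.tendsto_exp_atTop).congr fun t => (key t).symm

/-! ### Regularity at the origin -/

lemma contDiffOn_two_of_hasDerivWithinAt {s : Set ℝ} (hs : UniqueDiffOn ℝ s) {w w₁ w₂ : ℝ → ℝ}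
    (h1 : ∀ r ∈ s, HasDerivWithinAt w (w₁ r) s r) (h2 : ∀ r ∈ s, HasDerivWithinAt w₁ (w₂ r) s r)
    (h3 : ContinuousOn w₂ s) : ContDiffOn ℝ 2 w s := by
  have e1 : ∀ r ∈ s, derivWithin w s r = w₁ r := fun r hr => (h1 r hr).derivWithin (hs r hr)
  have e2 : ∀ r ∈ s, derivWithin w₁ s r = w₂ r := fun r hr => (h2 r hr).derivWithin (hs r hr)
  have h4 : ContDiffOn ℝ 1 w₁ s :=
    (contDiffOn_one_iff_derivWithin hs).2
      ⟨fun r hr => (h2 r hr).differentiableWithinAt, h3.congr e2⟩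
  have := (contDiffOn_succ_iff_derivWithin (f := w) (n := 1) hs).2
    ⟨fun r hr => (h1 r hr).differentiableWithinAt, by simp, h4.congr e1⟩
  simpa [one_add_one_eq_two] using this

/-- For a solution with a limit at the origin and vanishing flux `r^{N-1} u'`, the quotient `u'/r`
converges at the origin. -/
lemma IsSolution.tendsto_deriv_div {N : ℕ} (hN : 3 ≤ N) {α : ℝ} (hα : 0 < α) {u : ℝ → ℝ}
    (hu : IsSolution N α u) {l : ℝ} (hl : Tendsto u (𝓝[>] 0) (𝓝 l))
    (hflux : Tendsto (fun r : ℝ => r ^ (N - 1) * deriv u r) (𝓝[>] 0) (𝓝 0)) :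
    Tendsto (fun r => deriv u r / r) (𝓝[>] 0) (𝓝 (-(|l| ^ α * l) / N)) := by
  have hN' : (N : ℝ) ≠ 0 := by positivity
  -- L'Hôpital's rule, from the divergence form `(r^{N-1} u')' = -r^{N-1} |u|^α u`.
  have h1 : Tendsto (fun r : ℝ => (r ^ (N - 1) * deriv u r) / r ^ N) (𝓝[>] 0)
      (𝓝 (-(|l| ^ α * l) / N)) := by
    refine HasDerivAt.lhopital_zero_nhdsGT
      (f' := fun r => -(r ^ (N - 1) * (|u r| ^ α * u r))) (g' := fun r => N * r ^ (N - 1))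
      ?_ ?_ ?_ hflux ?_ ?_
    · filter_upwards [self_mem_nhdsWithin] with r hr
      have hr : 0 < r := hr
      refine ((hasDerivAt_pow (N - 1) r).mul (hu.hasDerivAt_deriv hr)).congr_deriv ?_
      have h2 := hu.2 r hr
      obtain ⟨k, rfl⟩ : ∃ k, N = k + 2 := ⟨N - 2, by omega⟩
      simp only [show k + 2 - 1 = k + 1 by omega, Nat.add_sub_cancel]
      push_cast at h2 ⊢
      field_simp at h2
      rw [pow_succ]
      linear_combination r ^ k * h2
    · exact Eventually.of_forall fun r => hasDerivAt_pow N r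
    · filter_upwards [self_mem_nhdsWithin] with r hr
      have hr : 0 < r := hr
      positivity
    · have : Tendsto (fun r : ℝ => r ^ N) (𝓝 0) (𝓝 (0 ^ N)) := (continuous_pow N).tendsto 0
      rw [zero_pow (by omega)] at this
      exact this.mono_left nhdsWithin_le_nhds
    · have h2 := (((continuous_abs_rpow_mul_self hα).tendsto l).comp hl).neg.div_const (N : ℝ)
      refine h2.congr' ?_
      filter_upwards [self_mem_nhdsWithin] with r hr
      have hr : 0 < r := hr
      simp only [Function.comp]
      field_simp
  refine h1.congr' ?_
  filter_upwards [self_mem_nhdsWithin] with r hr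
  have hr : 0 < r := hr
  obtain ⟨k, rfl⟩ : ∃ k, N = k + 1 := ⟨N - 1, by omega⟩
  simp only [Nat.add_sub_cancel, pow_succ]
  field_simp

lemma tendsto_deriv_zero_of_tendsto_div {u : ℝ → ℝ} {c : ℝ}
    (h : Tendsto (fun r => deriv u r / r) (𝓝[>] 0) (𝓝 c)) :
    Tendsto (deriv u) (𝓝[>] 0) (𝓝 0) := by
  have h1 : Tendsto (fun r : ℝ => r) (𝓝[>] 0) (𝓝 0) := tendsto_id.mono_left nhdsWithin_le_nhds
  have := h.mul h1
  rw [mul_zero] at this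
  refine this.congr' ?_
  filter_upwards [self_mem_nhdsWithin] with r hr
  have hr : r ≠ 0 := (mem_Ioi.1 hr).ne'
  field_simp

lemma hasDerivWithinAt_update_zero {u : ℝ → ℝ} (hu : ∀ r, 0 < r → HasDerivAt u (deriv u r) r)
    {l l' : ℝ} (hl : Tendsto u (𝓝[>] 0) (𝓝 l)) (hl' : Tendsto (deriv u) (𝓝[>] 0) (𝓝 l')) :
    ∀ r ∈ Ici (0 : ℝ), HasDerivWithinAt (Function.update u 0 l)
      (Function.update (deriv u) 0 l' r) (Ici 0) r := by
  have hev : ∀ r : ℝ, 0 < r → Function.update u 0 l =ᶠ[𝓝 r] u := fun r hr => by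
    filter_upwards [Ioi_mem_nhds hr] with s hs
    exact Function.update_of_ne (mem_Ioi.1 hs).ne' _ _
  have hd : ∀ r : ℝ, 0 < r → HasDerivAt (Function.update u 0 l) (deriv u r) r := fun r hr =>
    (hu r hr).congr_of_eventuallyEq (hev r hr)
  intro r hr
  rcases (mem_Ici.1 hr).eq_or_lt with rfl | hr
  · rw [Function.update_self]
    refine hasDerivWithinAt_Ici_of_tendsto_deriv (s := Ioi 0)
      (fun s hs => (hd s hs).differentiableAt.differentiableWithinAt) ?_ self_mem_nhdsWithin ?_
    · rw [ContinuousWithinAt, Function.update_self]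
      refine hl.congr' ?_
      filter_upwards [self_mem_nhdsWithin] with s hs
      exact (Function.update_of_ne (mem_Ioi.1 hs).ne' _ _).symm
    · refine hl'.congr' ?_
      filter_upwards [self_mem_nhdsWithin] with s hs
      exact (hd s hs).deriv.symm
  · rw [Function.update_of_ne hr.ne']
    exact (hd r hr).hasDerivWithinAt

lemma IsSolution.isRegularSolution {N : ℕ} {α : ℝ} (hα : 0 < α) {u : ℝ → ℝ}
    (hu : IsSolution N α u) {l c : ℝ} (hl : Tendsto u (𝓝[>] 0) (𝓝 l))
    (hc : Tendsto (fun r => deriv u r / r) (𝓝[>] 0) (𝓝 c)) : IsRegularSolution u := by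
  have h0 := tendsto_deriv_zero_of_tendsto_div hc
  -- The equation itself gives the limit of `u''` from those of `u'/r` and `u`.
  have h2 : Tendsto (deriv (deriv u)) (𝓝[>] 0) (𝓝 (-(((N : ℝ) - 1) * c) - |l| ^ α * l)) := by
    refine ((hc.const_mul ((N : ℝ) - 1)).neg.sub
      (((continuous_abs_rpow_mul_self hα).tendsto l).comp hl)).congr' ?_
    filter_upwards [self_mem_nhdsWithin] with r hr
    have := hu.2 r hr
    simp only [Function.comp]
    rw [div_mul_eq_mul_div, mul_div_assoc] at this
    linear_combination -this
  have d1 := hasDerivWithinAt_update_zero (fun r hr => hu.hasDerivAt hr) hl h0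
  have d2 := hasDerivWithinAt_update_zero (fun r hr => hu.hasDerivAt_deriv hr) h0 h2
  refine ⟨Function.update u 0 l, contDiffOn_two_of_hasDerivWithinAt (uniqueDiffOn_Ici 0) d1 d2 ?_,
    fun r hr => (Function.update_of_ne (mem_Ioi.1 hr).ne' _ _).symm, ?_⟩
  · intro r hr
    rcases (mem_Ici.1 hr).eq_or_lt with rfl | hr
    · rw [ContinuousWithinAt, Function.update_self, ← Ioi_insert, nhdsWithin_insert]
      refine Tendsto.sup ?_ ?_
      · rw [← Function.update_self (0 : ℝ) (-(((N : ℝ) - 1) * c) - |l| ^ α * l) (deriv (deriv u))]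
        simp
        exact fun s hs => by simpa using mem_of_mem_nhds hs
      · refine h2.congr' ?_
        filter_upwards [self_mem_nhdsWithin] with s hs
        exact (Function.update_of_ne (mem_Ioi.1 hs).ne' _ _).symm
    · have h3 : ContinuousOn (deriv (deriv u)) (Ioi 0) :=
        ((contDiffOn_succ_iff_deriv_of_isOpen (n := 0) isOpen_Ioi).1
          (by simpa using hu.contDiffOn_deriv)).2.2.continuousOn
      have h4 : ContinuousAt (deriv (deriv u)) r := h3.continuousAt (Ioi_mem_nhds hr)
      refine (h4.congr ?_).continuousWithinAt
      filter_upwards [Ioi_mem_nhds hr] with s hs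
      exact (Function.update_of_ne (mem_Ioi.1 hs).ne' _ _).symm
  · have := (d1 0 self_mem_Ici).derivWithin (uniqueDiffOn_Ici 0 0 self_mem_Ici)
    rwa [Function.update_self] at this

lemma IsRegularSolution.exists_tendsto {u : ℝ → ℝ} (h : IsRegularSolution u) :
    ∃ l, Tendsto u (𝓝[>] 0) (𝓝 l) := by
  obtain ⟨w, hw, huw, -⟩ := h
  refine ⟨w 0, ?_⟩
  have h1 : Tendsto w (𝓝[>] 0) (𝓝 (w 0)) :=
    (hw.continuousOn 0 self_mem_Ici).mono_left (nhdsWithin_mono 0 Ioi_subset_Ici_self)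
  refine h1.congr' ?_
  filter_upwards [self_mem_nhdsWithin] with r hr using (huw hr).symm

/-! ### Classification of the solutions -/

section

variable {N : ℕ} {α : ℝ} {u : ℝ → ℝ}

lemma IsSolution.exists_abs_le_rpow (hN : 3 ≤ N) (hα₁ : 2 / ((N : ℝ) - 2) < α)
    (hα₂ : α < 4 / ((N : ℝ) - 2)) (hu : IsSolution N α u) :
    ∃ C : ℝ, ∀ r : ℝ, 1 < r → |u r| ≤ C * r ^ (-((N : ℝ) - 2 - 2 / α)) := by
  obtain ⟨hα, hp, hq, hqp⟩ := exponents_pos hN hα₁ hα₂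
  obtain ⟨C, hC⟩ := (hu.isTrajectory hα).exists_abs_le_exp_growth hp hq hqp hα
  refine ⟨C, fun r hr => ?_⟩
  have hr0 : 0 < r := by linarith
  have h1 := hC (Real.log r) (Real.log_nonneg hr.le)
  rw [← rpow_mul_eq_emden u hr0, abs_mul, abs_of_pos (Real.rpow_pos_of_pos hr0 _),
    mul_comm _ (Real.log r), ← Real.rpow_def_of_pos hr0, Real.rpow_sub hr0] at h1
  rw [show -((N : ℝ) - 2 - 2 / α) = -decayExp N α from rfl, Real.rpow_neg hr0.le]
  have h2 := Real.rpow_pos_of_pos hr0 (2 / α)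
  have h3 : r ^ (2 / α) * |u r| ≤ r ^ (2 / α) * (C * (r ^ decayExp N α)⁻¹) :=
    h1.trans_eq (by field_simp)
  exact le_of_mul_le_mul_left h3 h2

/-- If the Emden–Fowler transform vanishes at `-∞`, then the solution is regular. -/
lemma IsSolution.regular_of_tendsto_emden_zero (hN : 3 ≤ N) (hα₁ : 2 / ((N : ℝ) - 2) < α)
    (hα₂ : α < 4 / ((N : ℝ) - 2)) (hu : IsSolution N α u)
    (h : Tendsto (emden (2 / α) u) atBot (𝓝 0)) :
    IsRegularSolution u ∧ ∃ l, Tendsto u (𝓝[>] 0) (𝓝 l) ∧ Tendsto (deriv u) (𝓝[>] 0) (𝓝 0) := by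
  obtain ⟨hα, hp, hq, hqp⟩ := exponents_pos hN hα₁ hα₂
  have ht := hu.isTrajectory hα
  obtain ⟨h', -⟩ := ht.exists_tendsto_atBot hp hq hqp hα
  -- In reversed time the decay rate is `p`, and `e^{-pt} v(t) = u(e^t)`; so the sharp asymptotics
  -- is the existence of the limit of `u`.
  obtain ⟨l, hl, -⟩ := ht.reverse.exists_tendsto_exp_mul hq hp hα
    (h.comp tendsto_neg_atTop_atBot)
    (by simpa using (h'.comp tendsto_neg_atTop_atBot).neg)
  have hul : Tendsto u (𝓝[>] 0) (𝓝 l) := by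
    refine (hl.comp (tendsto_neg_atBot_atTop.comp Real.tendsto_log_nhdsGT_zero)).congr' ?_
    filter_upwards [self_mem_nhdsWithin] with r hr
    simp only [Function.comp, neg_neg, emden, Real.exp_log (mem_Ioi.1 hr)]
    rw [← mul_assoc, ← Real.exp_add]
    simp
  -- `r^{N-1} u'` is `r^q` times `r^{p+1} u'`, and the latter tends to `0` along with `v` and `v'`.
  have hflux : Tendsto (fun r : ℝ => r ^ (N - 1) * deriv u r) (𝓝[>] 0) (𝓝 0) := by
    have h1 := tendsto_rpow_mul_deriv_of_emden h h'
    have h2 : Tendsto (fun r : ℝ => r ^ decayExp N α) (𝓝[>] 0) (𝓝 0) := by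
      have := (Real.continuousAt_rpow_const 0 (decayExp N α) (Or.inr hq.le)).tendsto
      rw [Real.zero_rpow hq.ne'] at this
      exact this.mono_left nhdsWithin_le_nhds
    have h3 := h2.mul h1
    rw [zero_mul] at h3
    refine h3.congr' ?_
    filter_upwards [self_mem_nhdsWithin] with r hr
    have hr : 0 < r := hr
    rw [← mul_assoc, ← Real.rpow_add hr, ← Real.rpow_natCast, Nat.cast_sub (by omega), decayExp]
    ring_nf
  have hdiv := hu.tendsto_deriv_div hN hα hul hflux
  exact ⟨hu.isRegularSolution hα hul hdiv, l, hul, tendsto_deriv_zero_of_tendsto_div hdiv⟩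

lemma isSingular_of_tendsto_emden {p l : ℝ} (hp : 0 < p) (hl : l ≠ 0)
    (h : Tendsto (emden p u) atBot (𝓝 l)) : IsSingular u := by
  rintro ⟨c, hc⟩
  exact hl (tendsto_nhds_unique h (tendsto_emden_zero_of_tendsto hp hc))

/-- Both transforms tend to `0` at `+∞`, with derivatives tending to `0` by positivity. Equal `lam`
makes the limit of `e^{qt}` times their difference zero, and this forces them to coincide. -/
lemma HasULambdaAsymptotics.eqOn (hN : 3 ≤ N) (hα₁ : 2 / ((N : ℝ) - 2) < α)
    (hα₂ : α < 4 / ((N : ℝ) - 2)) {lam : ℝ} {w w' : ℝ → ℝ}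
    (h : HasULambdaAsymptotics N α lam w) (h' : HasULambdaAsymptotics N α lam w') :
    EqOn w' w (Ioi 0) := by
  obtain ⟨hα, hp, hq, hqp⟩ := exponents_pos hN hα₁ hα₂
  have key : ∀ w : ℝ → ℝ, HasULambdaAsymptotics N α lam w →
      Tendsto (fun t => Real.exp (decayExp N α * t) * emden (2 / α) w t) atTop (𝓝 lam) ∧
      Tendsto (emden (2 / α) w) atTop (𝓝 0) ∧ Tendsto (emdenDeriv (2 / α) w) atTop (𝓝 0) := by
    intro w h
    have h1 : Tendsto (fun t => Real.exp (decayExp N α * t) * emden (2 / α) w t) atTop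
        (𝓝 lam) := by
      rw [tendsto_atTop_emden]
      simpa [decayExp] using h.at_top
    refine ⟨h1, ?_, ?_⟩
    · have h2 : Tendsto (fun t => Real.exp (-(decayExp N α * t))) atTop (𝓝 0) :=
        Real.tendsto_exp_neg_atTop_nhds_zero.comp (tendsto_id.const_mul_atTop hq)
      have h3 := h2.mul h1
      rw [zero_mul] at h3
      refine h3.congr fun t => ?_
      rw [← mul_assoc, ← Real.exp_add]; simp
    · exact ((h.isSolution.isTrajectory hα).exists_tendsto_of_eventually_pos hp hq hqp hα
        (T := 0) (fun t _ => emden_pos_iff.2 (h.pos _ (Real.exp_pos t)))).1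
  obtain ⟨a1, a2, a3⟩ := key w h
  obtain ⟨b1, b2, b3⟩ := key w' h'
  obtain ⟨L, hL, hL0⟩ := (h'.isSolution.isTrajectory hα).exists_tendsto_exp_mul_sub hp hq hα
    b2 b3 (h.isSolution.isTrajectory hα) a2 a3
  have hL' : L = 0 := by
    refine tendsto_nhds_unique hL ?_
    have := b1.sub a1
    rw [sub_self] at this
    exact this.congr fun t => by ring
  intro r hr
  have hr : 0 < r := hr
  have h1 := hL0 hL' (Real.log r)
  rw [← rpow_mul_eq_emden _ hr, ← rpow_mul_eq_emden _ hr] at h1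
  exact mul_left_cancel₀ (Real.rpow_pos_of_pos hr _).ne' h1

/-- A positive singular solution vanishing fast enough is some `u_lam`. -/
lemma IsSolution.exists_isULambda (hN : 3 ≤ N) (hα₁ : 2 / ((N : ℝ) - 2) < α)
    (hα₂ : α < 4 / ((N : ℝ) - 2)) (hu : IsSolution N α u) (hpos : ∀ r, 0 < r → 0 < u r)
    (h0 : Tendsto (emden (2 / α) u) atBot (𝓝 (beta N α ^ (1 / α))))
    (hv : Tendsto (emden (2 / α) u) atTop (𝓝 0))
    (hv' : Tendsto (emdenDeriv (2 / α) u) atTop (𝓝 0)) :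
    ∃ lam : ℝ, 0 < lam ∧ IsULambda N α lam u := by
  obtain ⟨hα, hp, hq, hqp⟩ := exponents_pos hN hα₁ hα₂
  obtain ⟨L, hL, hL0⟩ := (hu.isTrajectory hα).exists_tendsto_exp_mul hp hq hα hv hv'
  have hvpos : ∀ t, 0 < emden (2 / α) u t := fun t => emden_pos_iff.2 (hpos _ (Real.exp_pos t))
  have hLnn : 0 ≤ L := ge_of_tendsto hL (Eventually.of_forall fun t =>
    mul_nonneg (Real.exp_pos _).le (hvpos t).le)
  have hLne : L ≠ 0 := fun h => (hvpos 0).ne' (hL0 h 0)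
  rw [tendsto_atTop_emden, decayExp, add_sub_cancel] at hL
  have h1 : HasULambdaAsymptotics N α L u := ⟨hu, hpos, tendsto_rpow_mul_of_emden h0, hL⟩
  exact ⟨L, lt_of_le_of_ne hLnn hLne.symm, h1, fun w' hw' => h1.eqOn hN hα₁ hα₂ hw'⟩

lemma IsSolution.isConstantSignSingular_of_pos (hN : 3 ≤ N) (hα₁ : 2 / ((N : ℝ) - 2) < α)
    (hα₂ : α < 4 / ((N : ℝ) - 2)) (hu : IsSolution N α u) (hpos : ∀ r, 0 < r → 0 < u r) {l : ℝ}
    (hl0 : l ≠ 0) (hl : Tendsto (emden (2 / α) u) atBot (𝓝 l))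
    (hE : ∀ t, trajEnergy (2 / α) (decayExp N α) α (emden (2 / α) u) (emdenDeriv (2 / α) u) t ≤ 0) :
    (∀ r : ℝ, 0 < r → u r = beta N α ^ (1 / α) * r ^ (-(2 / α))) ∨
      ∃ lam : ℝ, 0 < lam ∧ IsULambda N α lam u := by
  obtain ⟨hα, hp, hq, hqp⟩ := exponents_pos hN hα₁ hα₂
  have ht := hu.isTrajectory hα
  have hvpos : ∀ t, 0 < emden (2 / α) u t := fun t => emden_pos_iff.2 (hpos _ (Real.exp_pos t))
  have hlb : l = beta N α ^ (1 / α) := by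
    obtain ⟨-, l', hl', h1⟩ := ht.exists_tendsto_atBot hp hq hqp hα
    obtain rfl := tendsto_nhds_unique h1 hl
    have hnn : 0 ≤ l' := ge_of_tendsto hl (Eventually.of_forall fun t => (hvpos t).le)
    have hβ : 0 < 2 / α * decayExp N α := mul_pos hp hq
    rcases (equilibrium_iff hβ hα).1 hl' with h | h | h
    · exact absurd h hl0
    · exact h
    · have := Real.rpow_pos_of_pos hβ (1 / α)
      linarith
  rcases ht.eq_const_or_tendsto_zero_of_energy_neg hp hq hqp hα hE hl0 hl with h | ⟨h, h'⟩
  · left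
    intro r hr
    have h1 := h (Real.log r)
    rw [← rpow_mul_eq_emden u hr, hlb] at h1
    rw [← h1, Real.rpow_neg hr.le]
    have := (Real.rpow_pos_of_pos hr (2 / α)).ne'
    field_simp
  · right
    exact hu.exists_isULambda hN hα₁ hα₂ hpos (hlb ▸ hl) h h'

/-- Negative energy excludes zeros, so `u` has a constant sign; the negative case reduces to the
positive one by `u ↦ -u`. -/
lemma IsSolution.isConstantSignSingular (hN : 3 ≤ N) (hα₁ : 2 / ((N : ℝ) - 2) < α)
    (hα₂ : α < 4 / ((N : ℝ) - 2)) (hu : IsSolution N α u) {l : ℝ}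
    (hl0 : l ≠ 0) (hl : Tendsto (emden (2 / α) u) atBot (𝓝 l))
    (hE : ∀ t, trajEnergy (2 / α) (decayExp N α) α (emden (2 / α) u) (emdenDeriv (2 / α) u) t < 0) :
    IsConstantSignSingular N α u ∧ ¬ IsSignChanging u := by
  obtain ⟨hα, hp, hq, hqp⟩ := exponents_pos hN hα₁ hα₂
  have ht := hu.isTrajectory hα
  have hne : ∀ t, emden (2 / α) u t ≠ 0 := fun t => ne_zero_of_energy_neg hα (hE t)
  have hsign : (∀ t, 0 < emden (2 / α) u t) ∨ (∀ t, emden (2 / α) u t < 0) := by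
    by_contra hcon
    push Not at hcon
    obtain ⟨⟨s, hs⟩, t, ht'⟩ := hcon
    obtain ⟨x, -, hx⟩ := isPreconnected_univ.intermediate_value (mem_univ s) (mem_univ t)
      ht.continuous_left.continuousOn (show (0 : ℝ) ∈ Icc _ _ from ⟨hs, ht'⟩)
    exact hne x hx
  rcases hsign with hs | hs
  · have hpos : ∀ r, 0 < r → 0 < u r := fun r hr => by
      have := emden_pos_iff.1 (hs (Real.log r)); rwa [Real.exp_log hr] at this
    refine ⟨?_, fun h => ?_⟩
    · rcases hu.isConstantSignSingular_of_pos hN hα₁ hα₂ hpos hl0 hl (fun t => (hE t).le) with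
        h | ⟨lam, hlam, h⟩
      · exact Or.inl h
      · exact Or.inr (Or.inr ⟨lam, hlam, u, h, Or.inl fun _ _ => rfl⟩)
    · obtain ⟨-, r, hr, hr'⟩ := h
      linarith [hpos r hr]
  · have hpos : ∀ r, 0 < r → 0 < -u r := fun r hr => by
      have := emden_neg_iff.1 (hs (Real.log r)); rw [Real.exp_log hr] at this; linarith
    refine ⟨?_, fun h => ?_⟩
    · have e1 : emden (2 / α) (fun r => -u r) = fun t => -emden (2 / α) u t :=
        funext (emden_neg _ u)
      have e2 : emdenDeriv (2 / α) (fun r => -u r) = fun t => -emdenDeriv (2 / α) u t := by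
        ext t
        simp only [emdenDeriv, deriv.fun_neg]; ring
      rcases hu.neg.isConstantSignSingular_of_pos hN hα₁ hα₂ hpos (neg_ne_zero.2 hl0)
        (e1 ▸ hl.neg) (fun t => by rw [e1, e2, energy_neg]; exact (hE t).le) with
        h | ⟨lam, hlam, h⟩
      · exact Or.inr (Or.inl fun r hr => by rw [← h r hr, neg_neg])
      · exact Or.inr (Or.inr ⟨lam, hlam, _, h, Or.inr fun _ _ => by rw [neg_neg]⟩)
    · obtain ⟨⟨r, hr, hr'⟩, -⟩ := h
      linarith [hpos r hr]

/-- The solutions fall into three classes, distinguished by the limit of the Emden–Fowler transform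
at `-∞` and the zeros of the energy. -/
lemma IsSolution.classification (hN : 3 ≤ N) (hα₁ : 2 / ((N : ℝ) - 2) < α)
    (hα₂ : α < 4 / ((N : ℝ) - 2)) (hu : IsSolution N α u) (hu₀ : ∃ r : ℝ, 0 < r ∧ u r ≠ 0) :
    (IsRegularSolution u ∧ OscillatesAtInfinity u ∧ ¬ IsSingular u ∧
      (∃ l : ℝ, Tendsto u (𝓝[>] 0) (𝓝 l) ∧ Tendsto (deriv u) (𝓝[>] 0) (𝓝 0)) ∧
      ¬ ∃ r₀ : ℝ, 0 < r₀ ∧ energy N α u r₀ = 0) ∨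
    (¬ IsRegularSolution u ∧ IsSingular u ∧
      (∃ σ : ℝ, (σ = 1 ∨ σ = -1) ∧
        Tendsto (fun r : ℝ => r ^ (2 / α) * u r) (𝓝[>] 0) (𝓝 (σ * beta N α ^ (1 / α))) ∧
        Tendsto (fun r : ℝ => r ^ (2 / α + 1) * deriv u r) (𝓝[>] 0)
          (𝓝 (-σ * (2 / α * beta N α ^ (1 / α))))) ∧
      ((IsSignChanging u ∧ OscillatesAtInfinity u ∧ ∃ r₀ : ℝ, 0 < r₀ ∧ energy N α u r₀ = 0) ∨
        (¬ IsSignChanging u ∧ IsConstantSignSingular N α u ∧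
          ¬ ∃ r₀ : ℝ, 0 < r₀ ∧ energy N α u r₀ = 0))) := by
  obtain ⟨hα, hp, hq, hqp⟩ := exponents_pos hN hα₁ hα₂
  have ht := hu.isTrajectory hα
  have hne : ∃ t, emden (2 / α) u t ≠ 0 := by
    obtain ⟨r, hr, hr0⟩ := hu₀
    exact ⟨Real.log r, by
      rw [← rpow_mul_eq_emden u hr]; exact mul_ne_zero (Real.rpow_pos_of_pos hr _).ne' hr0⟩
  obtain ⟨h', l, hleq, hl⟩ := ht.exists_tendsto_atBot hp hq hqp hα
  have hosc : ∀ t, 0 < trajEnergy (2 / α) (decayExp N α) α (emden (2 / α) u)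
      (emdenDeriv (2 / α) u) t → OscillatesAtInfinity u := fun t hE =>
    oscillates_of_emden (ht.frequently_pos_of_energy_pos hp hq hqp hα hE)
      (ht.frequently_neg_of_energy_pos hp hq hqp hα hE)
  rw [energy_eq_zero_iff hα]
  by_cases hl0 : l = 0
  · left
    rw [hl0] at hl
    obtain ⟨hreg, hlim⟩ := hu.regular_of_tendsto_emden_zero hN hα₁ hα₂ hl
    have hE := ht.energy_pos_of_tendsto_zero hqp hα hne hl h'
    exact ⟨hreg, hosc 0 (hE 0), fun h => h hreg.exists_tendsto, hlim,
      fun ⟨t, h⟩ => (hE t).ne' h⟩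
  · right
    have hsing := isSingular_of_tendsto_emden hp hl0 hl
    refine ⟨fun h => hsing h.exists_tendsto, hsing, ?_, ?_⟩
    · have hβ : 0 < 2 / α * decayExp N α := mul_pos hp hq
      have h1 := tendsto_rpow_mul_of_emden hl
      have h2 := tendsto_rpow_mul_deriv_of_emden hl h'
      rcases (equilibrium_iff hβ hα).1 hleq with h | h | h
      · exact absurd h hl0
      · refine ⟨1, Or.inl rfl, ?_, ?_⟩
        · rw [one_mul]; exact h ▸ h1
        · have e : l = beta N α ^ (1 / α) := h
          rw [e] at h2
          convert h2 using 2; ring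
      · refine ⟨-1, Or.inr rfl, ?_, ?_⟩
        · rw [neg_one_mul]; exact h ▸ h1
        · have e : l = -beta N α ^ (1 / α) := h
          rw [e] at h2
          convert h2 using 2; ring
    -- The energy is negative near `-∞`: it either vanishes somewhere and is positive later, or
    -- stays negative by the intermediate value theorem.
    · by_cases hz : ∃ t, trajEnergy (2 / α) (decayExp N α) α (emden (2 / α) u)
          (emdenDeriv (2 / α) u) t = 0
      · left
        obtain ⟨t, hz'⟩ := hz
        have := hosc _ (ht.exists_energy_pos_of_energy_eq_zero hp hq hqp hα hne hz')
        exact ⟨this.isSignChanging, this, t, hz'⟩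
      · right
        have hE : ∀ t, trajEnergy (2 / α) (decayExp N α) α (emden (2 / α) u)
            (emdenDeriv (2 / α) u) t < 0 := by
          intro t
          by_contra hc
          push Not at hc
          have h1 := (tendsto_energy (p := 2 / α) (q := decayExp N α) hα hl h').eventually
            (gt_mem_nhds ((potential_nonpos hp hq hα hleq).2 hl0))
          obtain ⟨s, hs⟩ := h1.exists
          have hcont : Continuous (trajEnergy (2 / α) (decayExp N α) α (emden (2 / α) u)
            (emdenDeriv (2 / α) u)) :=
            continuous_iff_continuousAt.2 fun t => (ht.hasDerivAt_energy hα t).continuousAt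
          obtain ⟨x, -, hx⟩ := isPreconnected_univ.intermediate_value (mem_univ s) (mem_univ t)
            hcont.continuousOn (show (0 : ℝ) ∈ Icc _ _ from ⟨hs.le, hc⟩)
          exact hz ⟨x, hx⟩
        obtain ⟨h1, h2⟩ := hu.isConstantSignSingular hN hα₁ hα₂ hl0 hl hE
        exact ⟨h2, h1, hz⟩

/-- Near the origin, a solution is bounded by a multiple of `r^{-2/α}`. -/
lemma IsSolution.exists_abs_le_rpow_near_zero (hN : 3 ≤ N) (hα₁ : 2 / ((N : ℝ) - 2) < α)
    (hα₂ : α < 4 / ((N : ℝ) - 2)) (hu : IsSolution N α u) (R : ℝ) :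
    ∃ C : ℝ, 0 ≤ C ∧ ∀ r : ℝ, 0 < r → r ≤ R → |u r| ≤ C * r ^ (-(2 / α)) := by
  obtain ⟨hα, hp, hq, hqp⟩ := exponents_pos hN hα₁ hα₂
  have ht := hu.isTrajectory hα
  obtain ⟨M, hM⟩ := exists_bound_of_energy_le hp hq hα (trajEnergy (2 / α) (decayExp N α) α
    (emden (2 / α) u) (emdenDeriv (2 / α) u) (Real.log R))
  refine ⟨|M|, abs_nonneg M, fun r hr hrR => ?_⟩
  have h1 := (hM _ _ _ (ht.energy_monotone hqp hα (Real.log_le_log hr hrR))).1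
  have h2 := Real.rpow_pos_of_pos hr (2 / α)
  rw [← rpow_mul_eq_emden u hr, abs_mul, abs_of_pos h2] at h1
  rw [Real.rpow_neg hr.le, ← div_eq_mul_inv, le_div_iff₀ h2, mul_comm]
  exact h1.trans (le_abs_self M)

end

/-! ### Second directional derivatives and Green's identity -/

section Green

variable {E : Type*} [NormedAddCommGroup E] [NormedSpace ℝ E]

/-- The directional derivative of `f` along `v`. -/
noncomputable def dirDeriv (v : E) (f : E → ℝ) (x : E) : ℝ := fderiv ℝ f x v

lemma contDiffAt_dirDeriv {f : E → ℝ} {x : E} {n m : WithTop ℕ∞} (hf : ContDiffAt ℝ n f x)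
    (hmn : m + 1 ≤ n) (v : E) : ContDiffAt ℝ m (dirDeriv v f) x :=
  (hf.fderiv_right hmn).clm_apply contDiffAt_const

lemma contDiff_dirDeriv {f : E → ℝ} {n m : WithTop ℕ∞} (hf : ContDiff ℝ n f)
    (hmn : m + 1 ≤ n) (v : E) : ContDiff ℝ m (dirDeriv v f) :=
  contDiff_iff_contDiffAt.2 fun _ => contDiffAt_dirDeriv hf.contDiffAt hmn v

lemma hasCompactSupport_dirDeriv {f : E → ℝ} (hf : HasCompactSupport f) (v : E) :
    HasCompactSupport (dirDeriv v f) := hf.fderiv_apply (𝕜 := ℝ) v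

lemma dirDeriv_congr {f g : E → ℝ} {x : E} (h : f =ᶠ[𝓝 x] g) (v : E) :
    dirDeriv v f =ᶠ[𝓝 x] dirDeriv v g := by
  filter_upwards [h.fderiv (𝕜 := ℝ)] with y hy
  rw [dirDeriv, dirDeriv, hy]

lemma dirDeriv_mul {f g : E → ℝ} {x : E} (hf : DifferentiableAt ℝ f x)
    (hg : DifferentiableAt ℝ g x) (v : E) :
    dirDeriv v (fun y => f y * g y) x = f x * dirDeriv v g x + dirDeriv v f x * g x := by
  rw [dirDeriv, fderiv_fun_mul hf hg]
  simp [dirDeriv]; ring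

lemma dirDeriv_dirDeriv_mul {f g : E → ℝ} (hf : ContDiff ℝ 2 f) (hg : ContDiff ℝ 2 g) (v x : E) :
    dirDeriv v (dirDeriv v (fun y => f y * g y)) x
      = f x * dirDeriv v (dirDeriv v g) x + 2 * (dirDeriv v f x * dirDeriv v g x)
        + dirDeriv v (dirDeriv v f) x * g x := by
  have hf1 := hf.differentiable (by norm_num)
  have hg1 := hg.differentiable (by norm_num)
  have hf2 := (contDiff_dirDeriv hf (m := 1) (by norm_num [one_add_one_eq_two]) v).differentiable
    (by norm_num)
  have hg2 := (contDiff_dirDeriv hg (m := 1) (by norm_num [one_add_one_eq_two]) v).differentiable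
    (by norm_num)
  have h1 : dirDeriv v (fun y => f y * g y)
      = fun y => f y * dirDeriv v g y + dirDeriv v f y * g y :=
    funext fun y => dirDeriv_mul (hf1 y) (hg1 y) v
  have h2 : dirDeriv v (fun y => f y * dirDeriv v g y + dirDeriv v f y * g y) x
      = dirDeriv v (fun y => f y * dirDeriv v g y) x
        + dirDeriv v (fun y => dirDeriv v f y * g y) x := by
    have := ((hf1 x).fun_mul (hg2 x)).hasFDerivAt.fun_add ((hf2 x).fun_mul (hg1 x)).hasFDerivAt
    rw [dirDeriv, this.fderiv]
    rfl
  rw [h1, h2, dirDeriv_mul (hf1 x) (hg2 x), dirDeriv_mul (hf2 x) (hg1 x)]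
  ring

lemma dirDeriv_comp_smul {f : E → ℝ} (hf : Differentiable ℝ f) (c : ℝ) (v : E) :
    dirDeriv v (fun x => f (c • x)) = fun x => c * dirDeriv v f (c • x) := by
  ext x
  have h1 : HasFDerivAt (fun x : E => c • x) (c • ContinuousLinearMap.id ℝ E) x :=
    (hasFDerivAt_id x).const_smul c
  have h2 : HasFDerivAt (fun x => f (c • x))
      ((fderiv ℝ f (c • x)).comp (c • ContinuousLinearMap.id ℝ E)) x :=
    (hf (c • x)).hasFDerivAt.comp x h1
  rw [dirDeriv, h2.fderiv]
  simp [dirDeriv]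

lemma dirDeriv_const_mul {f : E → ℝ} {x : E} (hf : DifferentiableAt ℝ f x) (c : ℝ) (v : E) :
    dirDeriv v (fun x => c * f x) x = c * dirDeriv v f x := by
  rw [dirDeriv, fderiv_const_mul hf]
  rfl

lemma dirDeriv_dirDeriv_comp_smul {f : E → ℝ} (hf : ContDiff ℝ 2 f) (c : ℝ) (v x : E) :
    dirDeriv v (dirDeriv v (fun x => f (c • x))) x
      = c ^ 2 * dirDeriv v (dirDeriv v f) (c • x) := by
  have hf2 := (contDiff_dirDeriv hf (m := 1) (by norm_num [one_add_one_eq_two]) v).differentiable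
    (by norm_num)
  have hd : DifferentiableAt ℝ (fun x => dirDeriv v f (c • x)) x :=
    (hf2 _).comp x (differentiableAt_id.const_smul c)
  rw [dirDeriv_comp_smul (hf.differentiable (by norm_num)), dirDeriv_const_mul hd,
    dirDeriv_comp_smul hf2]
  ring

end Green

section Laplace

variable {E : Type*} [NormedAddCommGroup E] [InnerProductSpace ℝ E] [FiniteDimensional ℝ E]

lemma laplacian_eq_sum_dirDeriv {f : E → ℝ} {x : E} (hf : ContDiffAt ℝ 2 f x) {ι : Type*}
    [Fintype ι] (b : OrthonormalBasis ι ℝ E) :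
    Laplacian.laplacian f x = ∑ i, dirDeriv (b i) (dirDeriv (b i) f) x := by
  rw [InnerProductSpace.laplacian_eq_iteratedFDeriv_orthonormalBasis f b]
  refine Finset.sum_congr rfl fun i _ => ?_
  rw [iteratedFDeriv_two_apply]
  have h1 : DifferentiableAt ℝ (fderiv ℝ f) x :=
    (hf.fderiv_right (m := 1) (by norm_num [one_add_one_eq_two])).differentiableAt (by norm_num)
  have h2 : HasFDerivAt (dirDeriv (b i) f) _ x := h1.hasFDerivAt.clm_apply
    (hasFDerivAt_const (b i) x)
  rw [dirDeriv, h2.fderiv]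
  simp

variable [MeasurableSpace E] [BorelSpace E]

/-- Green's identity for a test function. -/
lemma integral_mul_laplacian {G ψ : E → ℝ} (hG : ContDiff ℝ 2 G) (hψ : ContDiff ℝ 2 ψ)
    (hc : HasCompactSupport ψ) :
    ∫ x, G x * Laplacian.laplacian ψ x = ∫ x, Laplacian.laplacian G x * ψ x := by
  set b := stdOrthonormalBasis ℝ E
  have two : (1 : WithTop ℕ∞) + 1 ≤ 2 := by norm_num [one_add_one_eq_two]
  have one : (0 : WithTop ℕ∞) + 1 ≤ 1 := by norm_num
  have hG1 : ∀ v, ContDiff ℝ 1 (dirDeriv v G) := fun v => contDiff_dirDeriv hG two v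
  have hψ1 : ∀ v, ContDiff ℝ 1 (dirDeriv v ψ) := fun v => contDiff_dirDeriv hψ two v
  have hG2 : ∀ v, Continuous (dirDeriv v (dirDeriv v G)) := fun v =>
    (contDiff_dirDeriv (hG1 v) one v).continuous
  have hψ2 : ∀ v, Continuous (dirDeriv v (dirDeriv v ψ)) := fun v =>
    (contDiff_dirDeriv (hψ1 v) one v).continuous
  have hcG : Continuous G := hG.continuous
  have hcψ : Continuous ψ := hψ.continuous
  have int : ∀ {f g : E → ℝ}, Continuous f → Continuous g → HasCompactSupport g →
      Integrable (fun x => f x * g x) := fun hf hg hgc =>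
    (hf.mul hg).integrable_of_hasCompactSupport hgc.mul_left
  have key : ∀ v : E, ∫ x, G x * dirDeriv v (dirDeriv v ψ) x
      = ∫ x, dirDeriv v (dirDeriv v G) x * ψ x := by
    intro v
    have hc1 : HasCompactSupport (dirDeriv v ψ) := hasCompactSupport_dirDeriv hc v
    have e1 := integral_mul_fderiv_eq_neg_fderiv_mul_of_integrable (μ := volume) (f := G)
      (g := dirDeriv v ψ) (v := v)
      (int (hG1 v).continuous (hψ1 v).continuous hc1)
      (int hcG (hψ2 v) (hasCompactSupport_dirDeriv hc1 v)) (int hcG (hψ1 v).continuous hc1)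
      (fun x _ => hG.differentiable (by norm_num) x) (fun x _ => (hψ1 v).differentiable (by norm_num) x)
    have e2 := integral_mul_fderiv_eq_neg_fderiv_mul_of_integrable (μ := volume)
      (f := dirDeriv v G) (g := ψ) (v := v)
      (int (hG2 v) hcψ hc) (int (hG1 v).continuous (hψ1 v).continuous hc1)
      (int (hG1 v).continuous hcψ hc)
      (fun x _ => (hG1 v).differentiable (by norm_num) x) (fun x _ => hψ.differentiable (by norm_num) x)
    refine e1.trans ?_
    rw [neg_eq_iff_eq_neg]
    exact e2
  calc ∫ x, G x * Laplacian.laplacian ψ x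
      = ∫ x, ∑ i, G x * dirDeriv (b i) (dirDeriv (b i) ψ) x := by
        refine integral_congr_ae (Eventually.of_forall fun x => ?_)
        simp only
        rw [laplacian_eq_sum_dirDeriv hψ.contDiffAt b, Finset.mul_sum]
    _ = ∑ i, ∫ x, G x * dirDeriv (b i) (dirDeriv (b i) ψ) x :=
        integral_finsetSum _ fun i _ => int hcG (hψ2 _)
          (hasCompactSupport_dirDeriv (hasCompactSupport_dirDeriv hc _) _)
    _ = ∑ i, ∫ x, dirDeriv (b i) (dirDeriv (b i) G) x * ψ x :=
        Finset.sum_congr rfl fun i _ => key _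
    _ = ∫ x, ∑ i, dirDeriv (b i) (dirDeriv (b i) G) x * ψ x :=
        (integral_finsetSum _ fun i _ => int (hG2 _) hcψ hc).symm
    _ = _ := by
        refine integral_congr_ae (Eventually.of_forall fun x => ?_)
        simp only
        rw [laplacian_eq_sum_dirDeriv hG.contDiffAt b, Finset.sum_mul]

end Laplace

/-! ### Radial functions -/

section Radial

variable {E : Type*} [NormedAddCommGroup E] [InnerProductSpace ℝ E]

lemma hasFDerivAt_norm_of_ne_zero {x : E} (hx : x ≠ 0) :
    HasFDerivAt (fun y : E => ‖y‖) (‖x‖⁻¹ • innerSL ℝ x) x := by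
  have hn : ‖x‖ ≠ 0 := norm_ne_zero_iff.2 hx
  have h1 := (hasStrictFDerivAt_norm_sq x).hasFDerivAt.sqrt (pow_ne_zero 2 hn)
  have h2 : (fun y : E => √(‖y‖ ^ 2)) = fun y => ‖y‖ :=
    funext fun y => Real.sqrt_sq (norm_nonneg y)
  rw [h2, Real.sqrt_sq (norm_nonneg x)] at h1
  refine h1.congr_fderiv ?_
  ext y
  simp
  field_simp

lemma dirDeriv_comp_norm {h : ℝ → ℝ} {h' : ℝ} {x : E} (hx : x ≠ 0)
    (hh : HasDerivAt h h' ‖x‖) (v : E) :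
    dirDeriv v (fun y => h ‖y‖) x = h' * (‖x‖⁻¹ * inner ℝ x v) := by
  have := hh.comp_hasFDerivAt x (hasFDerivAt_norm_of_ne_zero hx)
  rw [dirDeriv, show (fun y : E => h ‖y‖) = h ∘ norm from rfl, this.fderiv]
  simp

/-- The Laplacian of a radial function. -/
lemma laplacian_comp_norm [FiniteDimensional ℝ E] {h h' h'' : ℝ → ℝ} {x : E} (hx : x ≠ 0)
    (hh : ∀ r, 0 < r → HasDerivAt h (h' r) r) (hh' : ∀ r, 0 < r → HasDerivAt h' (h'' r) r)
    (hC : ContDiffAt ℝ 2 (fun y : E => h ‖y‖) x) :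
    Laplacian.laplacian (fun y : E => h ‖y‖) x
      = h'' ‖x‖ + ((Module.finrank ℝ E : ℝ) - 1) / ‖x‖ * h' ‖x‖ := by
  set b := stdOrthonormalBasis ℝ E
  have hn : 0 < ‖x‖ := norm_pos_iff.2 hx
  -- Summed over an orthonormal basis, the squares of `⟪x, v⟫` give `‖x‖²` by Parseval, and the last
  -- term gives the dimension times `h'/‖x‖`.
  have key : ∀ v : E, ‖v‖ = 1 → dirDeriv v (dirDeriv v (fun y => h ‖y‖)) x
      = (h'' ‖x‖ * ‖x‖⁻¹ - h' ‖x‖ * (‖x‖⁻¹) ^ 2) * ‖x‖⁻¹ * inner ℝ x v ^ 2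
        + h' ‖x‖ * ‖x‖⁻¹ := by
    intro v hv
    have h1 : dirDeriv v (fun y => h ‖y‖)
        =ᶠ[𝓝 x] fun y => (h' ‖y‖ * ‖y‖⁻¹) * inner ℝ y v := by
      filter_upwards [isOpen_ne.mem_nhds hx] with y hy
      rw [dirDeriv_comp_norm hy (hh _ (norm_pos_iff.2 hy)), mul_assoc]
    rw [(dirDeriv_congr h1 v).eq_of_nhds]
    have hk : HasDerivAt (fun r => h' r * r⁻¹) (h'' ‖x‖ * ‖x‖⁻¹ - h' ‖x‖ * (‖x‖⁻¹) ^ 2) ‖x‖ := by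
      refine ((hh' _ hn).mul (hasDerivAt_inv hn.ne')).congr_deriv ?_
      field_simp
      ring
    have hd1 : DifferentiableAt ℝ (fun y : E => h' ‖y‖ * ‖y‖⁻¹) x :=
      (hk.comp_hasFDerivAt x (hasFDerivAt_norm_of_ne_zero hx)).differentiableAt
    have hd2 : HasFDerivAt (fun y : E => inner ℝ y v) (innerSL ℝ v) x := by
      have := (innerSL ℝ v).hasFDerivAt (x := x)
      refine this.congr_of_eventuallyEq (Eventually.of_forall fun y => ?_)
      simp [real_inner_comm]
    rw [dirDeriv_mul hd1 hd2.differentiableAt, dirDeriv_comp_norm (h := fun r => h' r * r⁻¹) hx hk]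
    have h3 : dirDeriv v (fun y : E => inner ℝ y v) x = 1 := by
      rw [dirDeriv, hd2.fderiv]; simp [hv]
    rw [h3]; ring
  rw [laplacian_eq_sum_dirDeriv hC b]
  simp_rw [key _ (b.orthonormal.1 _)]
  rw [Finset.sum_add_distrib, ← Finset.mul_sum]
  have hs : ∑ i, inner ℝ x (b i) ^ 2 = ‖x‖ ^ 2 := b.sum_sq_inner_left x
  rw [hs]
  simp only [Finset.sum_const, Finset.card_univ, Fintype.card_fin, nsmul_eq_mul]
  field_simp
  ring

end Radial

/-! ### Local integrability of negative powers of the norm -/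

section Integrable

variable {E : Type*} [NormedAddCommGroup E] [InnerProductSpace ℝ E] [FiniteDimensional ℝ E]
  [MeasurableSpace E] [BorelSpace E] [Nontrivial E]

/-- In polar coordinates the integrand is `r^{dim-1-s}` on a bounded interval, with exponent above
`-1`. -/
lemma integrable_indicator_norm_rpow {s R : ℝ} (hs : s < Module.finrank ℝ E) :
    Integrable (fun x : E => (Iic R).indicator (fun r : ℝ => r ^ (-s)) ‖x‖) := by
  rw [integrable_fun_norm_addHaar volume]
  set R' := max R 0
  have h1 : IntegrableOn (fun r : ℝ => r ^ ((Module.finrank ℝ E : ℝ) - 1 - s)) (Ioc 0 R') :=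
    (intervalIntegrable_iff_integrableOn_Ioc_of_le (le_max_right R 0)).1
      (intervalIntegral.intervalIntegrable_rpow' (by linarith))
  have h2 : IntegrableOn ((Iic R).indicator fun r : ℝ => r ^ ((Module.finrank ℝ E : ℝ) - 1 - s))
      (Ioi 0) := by
    rw [integrableOn_indicator_iff measurableSet_Iic]
    refine h1.mono_set ?_
    rintro r ⟨hr, hr'⟩
    exact ⟨hr', le_max_of_le_left hr⟩
  refine h2.congr_fun ?_ measurableSet_Ioi
  intro r hr
  have hr : 0 < r := hr
  simp only [smul_eq_mul]
  by_cases hrR : r ∈ Iic R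
  · rw [indicator_of_mem hrR, indicator_of_mem hrR, ← Real.rpow_natCast,
      Nat.cast_sub Module.finrank_pos, ← Real.rpow_add hr]
    norm_num
    ring_nf
  · rw [indicator_of_notMem hrR, indicator_of_notMem hrR, mul_zero]

lemma aestronglyMeasurable_of_continuousOn_compl {U : E → ℝ} (hU : ContinuousOn U {0}ᶜ) :
    AEStronglyMeasurable U volume := by
  have h1 := hU.aestronglyMeasurable (μ := volume) (measurableSet_singleton (0 : E)).compl
  rwa [Measure.restrict_eq_self_of_ae_mem] at h1
  rw [ae_iff]
  simp

lemma ae_ne_zero : ∀ᵐ x : E, x ≠ 0 := by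
  rw [ae_iff]; simp

lemma integrableOn_of_abs_le_norm_rpow {U : E → ℝ} (hU : ContinuousOn U {0}ᶜ) {s : ℝ}
    (hs : s < Module.finrank ℝ E)
    (hb : ∀ R : ℝ, ∃ C, ∀ x : E, x ≠ 0 → ‖x‖ ≤ R → |U x| ≤ C * ‖x‖ ^ (-s)) {K : Set E}
    (hK : IsCompact K) : IntegrableOn U K := by
  obtain ⟨R, hR⟩ := hK.isBounded.exists_norm_le
  obtain ⟨C, hC⟩ := hb R
  refine Integrable.mono' (((integrable_indicator_norm_rpow (R := R) hs).const_mul C).integrableOn)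
    (aestronglyMeasurable_of_continuousOn_compl hU).restrict ?_
  rw [ae_restrict_iff' hK.measurableSet]
  filter_upwards [ae_ne_zero] with x hx hxK
  rw [indicator_of_mem (mem_Iic.2 (hR x hxK))]
  exact hC x hx (hR x hxK)

end Integrable

/-! ### Removability of the origin for distributional solutions -/

section Cutoff

lemma exists_weighted_bound {E : Type*} [NormedAddCommGroup E] {g : E → ℝ} (hg : Continuous g)
    (hc : HasCompactSupport g) (k : ℕ) :
    ∃ C, 0 ≤ C ∧ ∀ x, |g x| * ‖x‖ ^ k ≤ C := by
  obtain ⟨C, hC⟩ := (hc.mul_right (f' := fun x => ‖x‖ ^ k)).exists_bound_of_continuous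
    (hg.mul (continuous_norm.pow k))
  refine ⟨C, (norm_nonneg _).trans (hC 0), fun x => ?_⟩
  have := hC x
  simpa [abs_mul] using this

variable {E : Type*} [NormedAddCommGroup E] [InnerProductSpace ℝ E] [FiniteDimensional ℝ E]

/-- The bump function equal to `1` on the unit ball and supported in the ball of radius `2`. -/
noncomputable def unitBump (E : Type*) [NormedAddCommGroup E] : ContDiffBump (0 : E) :=
  ⟨1, 2, one_pos, one_lt_two⟩

/-- A smooth function vanishing on the unit ball and equal to `1` outside the ball of radius `2`. -/
noncomputable def cutoff (x : E) : ℝ := 1 - unitBump E x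

lemma contDiff_cutoff : ContDiff ℝ 2 (cutoff (E := E)) :=
  contDiff_const.sub (unitBump E).contDiff

lemma cutoff_eq_zero {x : E} (hx : ‖x‖ ≤ 1) : cutoff x = 0 := by
  rw [cutoff, (unitBump E).one_of_mem_closedBall (by simpa [unitBump] using hx), sub_self]

lemma cutoff_eq_one {x : E} (hx : 2 ≤ ‖x‖) : cutoff x = 1 := by
  rw [cutoff, (unitBump E).zero_of_le_dist (by simpa [unitBump] using hx), sub_zero]

lemma abs_cutoff_le (x : E) : |cutoff x| ≤ 1 := by
  have h1 := (unitBump E).nonneg' x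
  have h2 := (unitBump E).le_one (x := x)
  rw [cutoff, abs_le]
  constructor <;> linarith

lemma dirDeriv_cutoff (v : E) :
    dirDeriv v (cutoff (E := E)) = fun x => -dirDeriv v (unitBump E) x := by
  ext x
  simp only [dirDeriv]
  rw [show (cutoff (E := E)) = fun x => 1 - unitBump E x from rfl, fderiv_const_sub]
  rfl

/-- A derivative of order `k` of the dilated cutoff is `c^k` times a derivative taken at `c x`, and
for `k = 1, 2` the latter times `‖c x‖^k` is bounded. The weight `‖x‖²` thus makes the bound
independent of `c`. -/
lemma exists_dirDeriv_mul_cutoff_bound {φ : E → ℝ} (hφ : ContDiff ℝ 2 φ)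
    (hc : HasCompactSupport φ) (v : E) : ∃ M, 0 ≤ M ∧ ∀ (c : ℝ) (x : E), 0 < c →
      |dirDeriv v (dirDeriv v (fun y => φ y * cutoff (c • y))) x| * ‖x‖ ^ 2 ≤ M := by
  have two : (1 : WithTop ℕ∞) + 1 ≤ 2 := by norm_num [one_add_one_eq_two]
  have one : (0 : WithTop ℕ∞) + 1 ≤ 1 := by norm_num
  have hb2 : ContDiff ℝ 2 (unitBump E) := (unitBump E).contDiff
  have hφ1 := contDiff_dirDeriv hφ two v
  have hb1 := contDiff_dirDeriv hb2 two v
  have hcφ1 := hasCompactSupport_dirDeriv hc v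
  have hcb1 := hasCompactSupport_dirDeriv (unitBump E).hasCompactSupport v
  obtain ⟨A₀, hA₀, hA₀'⟩ := exists_weighted_bound hφ.continuous hc 0
  obtain ⟨A₁, hA₁, hA₁'⟩ := exists_weighted_bound hφ1.continuous hcφ1 1
  obtain ⟨A₂, hA₂, hA₂'⟩ := exists_weighted_bound (contDiff_dirDeriv hφ1 one v).continuous
    (hasCompactSupport_dirDeriv hcφ1 v) 2
  obtain ⟨B₁, hB₁, hB₁'⟩ := exists_weighted_bound hb1.continuous hcb1 1
  obtain ⟨B₂, hB₂, hB₂'⟩ := exists_weighted_bound (contDiff_dirDeriv hb1 one v).continuous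
    (hasCompactSupport_dirDeriv hcb1 v) 2
  refine ⟨A₀ * B₂ + 2 * (A₁ * B₁) + A₂, by positivity, fun c x hc0 => ?_⟩
  have e2 : dirDeriv v (dirDeriv v (cutoff (E := E))) (c • x)
      = -dirDeriv v (dirDeriv v (unitBump E)) (c • x) := by
    rw [dirDeriv_cutoff, dirDeriv, fderiv_fun_neg]; rfl
  have hcut : ContDiff ℝ 2 (fun y : E => cutoff (c • y)) :=
    contDiff_cutoff.comp (contDiff_const_smul c)
  rw [dirDeriv_dirDeriv_mul hφ hcut,
    dirDeriv_dirDeriv_comp_smul contDiff_cutoff,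
    dirDeriv_comp_smul (contDiff_cutoff.differentiable (by norm_num)), e2, dirDeriv_cutoff]
  have a0 := hA₀' x
  have a1 := hA₁' x
  have a2 := hA₂' x
  have b1 := hB₁' (c • x)
  have b2 := hB₂' (c • x)
  rw [norm_smul, Real.norm_eq_abs, abs_of_pos hc0] at b1 b2
  rw [pow_zero, mul_one] at a0
  rw [pow_one] at a1 b1
  set d0 := φ x
  set d1 := dirDeriv v φ x
  set d2 := dirDeriv v (dirDeriv v φ) x
  set f1 := dirDeriv v (unitBump E) (c • x)
  set f2 := dirDeriv v (dirDeriv v (unitBump E)) (c • x)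
  have h3 := abs_cutoff_le (c • x)
  have t1 : |d0 * (c ^ 2 * -f2)| * ‖x‖ ^ 2 ≤ A₀ * B₂ := by
    have : |d0 * (c ^ 2 * -f2)| * ‖x‖ ^ 2 = |d0| * (|f2| * (c * ‖x‖) ^ 2) := by
      rw [abs_mul, abs_mul, abs_neg, abs_of_pos (by positivity : 0 < c ^ 2)]; ring
    rw [this]; gcongr
  have t2 : |2 * (d1 * (c * -f1))| * ‖x‖ ^ 2 ≤ 2 * (A₁ * B₁) := by
    have : |2 * (d1 * (c * -f1))| * ‖x‖ ^ 2 = 2 * ((|d1| * ‖x‖) * (|f1| * (c * ‖x‖))) := by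
      rw [abs_mul, abs_mul, abs_mul, abs_neg, abs_of_pos hc0, abs_two]; ring
    rw [this]; gcongr
  have t3 : |d2 * cutoff (c • x)| * ‖x‖ ^ 2 ≤ A₂ := by
    have : |d2 * cutoff (c • x)| * ‖x‖ ^ 2 = (|d2| * ‖x‖ ^ 2) * |cutoff (c • x)| := by
      rw [abs_mul]; ring
    rw [this]
    calc _ ≤ A₂ * 1 := by gcongr
      _ = A₂ := mul_one _
  have t4 := abs_add_three (d0 * (c ^ 2 * -f2)) (2 * (d1 * (c * -f1))) (d2 * cutoff (c • x))
  have t5 := mul_le_mul_of_nonneg_right t4 (sq_nonneg ‖x‖)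
  rw [add_mul, add_mul] at t5
  linarith

lemma exists_laplacian_mul_cutoff_bound {φ : E → ℝ} (hφ : ContDiff ℝ 2 φ)
    (hc : HasCompactSupport φ) : ∃ M, 0 ≤ M ∧ ∀ (c : ℝ) (x : E), 0 < c →
      |Laplacian.laplacian (fun y => φ y * cutoff (c • y)) x| * ‖x‖ ^ 2 ≤ M := by
  set b := stdOrthonormalBasis ℝ E
  choose M hM hM' using fun i => exists_dirDeriv_mul_cutoff_bound hφ hc (b i)
  refine ⟨∑ i, M i, Finset.sum_nonneg fun i _ => hM i, fun c x hc0 => ?_⟩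
  have h1 : ContDiff ℝ 2 (fun y => φ y * cutoff (c • y)) :=
    hφ.mul (contDiff_cutoff.comp (contDiff_const_smul c))
  rw [laplacian_eq_sum_dirDeriv h1.contDiffAt b]
  calc _ ≤ (∑ i, |dirDeriv (b i) (dirDeriv (b i) (fun y => φ y * cutoff (c • y))) x|)
        * ‖x‖ ^ 2 := by gcongr; exact Finset.abs_sum_le_sum_abs _ _
    _ = ∑ i, |dirDeriv (b i) (dirDeriv (b i) (fun y => φ y * cutoff (c • y))) x| * ‖x‖ ^ 2 :=
        Finset.sum_mul _ _ _
    _ ≤ _ := Finset.sum_le_sum fun i _ => hM' i c x hc0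

lemma continuous_laplacian {ψ : E → ℝ} (hψ : ContDiff ℝ 2 ψ) :
    Continuous (Laplacian.laplacian ψ) := by
  set b := stdOrthonormalBasis ℝ E
  have : Laplacian.laplacian ψ = fun x => ∑ i, dirDeriv (b i) (dirDeriv (b i) ψ) x :=
    funext fun x => laplacian_eq_sum_dirDeriv hψ.contDiffAt b
  rw [this]
  exact continuous_finsetSum _ fun i _ => (contDiff_dirDeriv (m := 0)
    (contDiff_dirDeriv hψ (m := 1) (by norm_num [one_add_one_eq_two]) _) (by norm_num) _).continuous

lemma laplacian_eq_zero_of_eventuallyEq {ψ : E → ℝ} {x : E} (h : ψ =ᶠ[𝓝 x] fun _ => 0) :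
    Laplacian.laplacian ψ x = 0 := by
  rw [(InnerProductSpace.laplacian_congr_nhds h).eq_of_nhds]
  simp

lemma tendsto_cutoff_smul {x : E} (hx : x ≠ 0) :
    ∀ᶠ n : ℕ in atTop, (fun y : E => cutoff (((n : ℝ) + 1) • y)) =ᶠ[𝓝 x] fun _ => 1 := by
  have hn : 0 < ‖x‖ := norm_pos_iff.2 hx
  obtain ⟨n₀, hn₀⟩ := exists_nat_gt (2 / ‖x‖)
  filter_upwards [eventually_ge_atTop n₀] with n hle
  have h1 : {y : E | 2 < ((n : ℝ) + 1) * ‖y‖} ∈ 𝓝 x := by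
    refine (isOpen_lt continuous_const (by fun_prop)).mem_nhds ?_
    rw [div_lt_iff₀ hn] at hn₀
    have : (n₀ : ℝ) ≤ n := by exact_mod_cast hle
    show 2 < ((n : ℝ) + 1) * ‖x‖
    nlinarith
  filter_upwards [h1] with y hy
  have hy : 2 < ((n : ℝ) + 1) * ‖y‖ := hy
  exact cutoff_eq_one (by
    rw [norm_smul, Real.norm_eq_abs, abs_of_pos (by positivity)]; exact hy.le)

variable [MeasurableSpace E] [BorelSpace E]

/-- Green's identity for a function which is `C²` away from the origin, tested against a function
vanishing near the origin. -/
lemma integral_mul_laplacian_mul_cutoff {U φ : E → ℝ} (hU : ContDiffOn ℝ 2 U {0}ᶜ)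
    (hφ : ContDiff ℝ 2 φ) (hc : HasCompactSupport φ) {c : ℝ} (hc0 : 0 < c) :
    ∫ x, U x * Laplacian.laplacian (fun y => φ y * cutoff (c • y)) x
      = ∫ x, Laplacian.laplacian U x * (φ x * cutoff (c • x)) := by
  have hnorm : ∀ (a : ℝ) (x : E), 0 < a → ‖a • x‖ = a * ‖x‖ := fun a x ha => by
    rw [norm_smul, Real.norm_eq_abs, abs_of_pos ha]
  -- The factor `2` makes `G = U` for `‖x‖ ≥ 1/c`, whereas `ψ = 0` for `‖x‖ ≤ 1/c`; so `G`, which is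
  -- `C²` everywhere, may replace `U`.
  set G : E → ℝ := fun x => U x * cutoff ((2 * c) • x) with hG
  set ψ : E → ℝ := fun y => φ y * cutoff (c • y) with hψ
  have hψ2 : ContDiff ℝ 2 ψ := hφ.mul (contDiff_cutoff.comp (contDiff_const_smul c))
  have hψc : HasCompactSupport ψ := hc.mul_right
  have hG2 : ContDiff ℝ 2 G := by
    refine contDiff_iff_contDiffAt.2 fun x => ?_
    by_cases hx : x = 0
    · refine (contDiffAt_const (c := (0 : ℝ))).congr_of_eventuallyEq ?_
      have h1 : {y : E | ‖(2 * c) • y‖ < 1} ∈ 𝓝 x := by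
        refine (isOpen_lt (by fun_prop) continuous_const).mem_nhds ?_
        simp [hx]
      filter_upwards [h1] with y hy
      have hy : ‖(2 * c) • y‖ < 1 := hy
      simp only [hG, cutoff_eq_zero hy.le, mul_zero]
    · exact (hU.contDiffAt (isOpen_compl_singleton.mem_nhds hx)).mul
        (contDiff_cutoff.comp (contDiff_const_smul (2 * c))).contDiffAt
  have hGU : ∀ x, 1 ≤ c * ‖x‖ → G x = U x := fun x hx => by
    simp only [hG]
    rw [cutoff_eq_one (by rw [hnorm _ _ (by positivity)]; linarith), mul_one]
  have h1 : ∀ x, U x * Laplacian.laplacian ψ x = G x * Laplacian.laplacian ψ x := by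
    intro x
    rcases le_or_gt 1 (c * ‖x‖) with hx | hx
    · rw [hGU x hx]
    · have : ψ =ᶠ[𝓝 x] fun _ => 0 := by
        have h1 : {y : E | c * ‖y‖ < 1} ∈ 𝓝 x :=
          (isOpen_lt (by fun_prop) continuous_const).mem_nhds hx
        filter_upwards [h1] with y hy
        have hy : c * ‖y‖ < 1 := hy
        simp only [hψ]
        rw [cutoff_eq_zero (by rw [hnorm _ _ hc0]; exact hy.le), mul_zero]
      rw [laplacian_eq_zero_of_eventuallyEq this, mul_zero, mul_zero]
  have h2 : ∀ x, Laplacian.laplacian G x * ψ x = Laplacian.laplacian U x * ψ x := by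
    intro x
    rcases le_or_gt (c * ‖x‖) 1 with hx | hx
    · have : ψ x = 0 := by
        simp only [hψ]
        rw [cutoff_eq_zero (by rw [hnorm _ _ hc0]; exact hx), mul_zero]
      rw [this, mul_zero, mul_zero]
    · have : G =ᶠ[𝓝 x] U := by
        have h1 : {y : E | 1 < c * ‖y‖} ∈ 𝓝 x :=
          (isOpen_lt continuous_const (by fun_prop)).mem_nhds hx
        filter_upwards [h1] with y hy using hGU y (le_of_lt hy)
      rw [(InnerProductSpace.laplacian_congr_nhds this).eq_of_nhds]
  simp_rw [h1]
  rw [integral_mul_laplacian hG2 hψ2 hψc]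
  simp_rw [h2]
  rfl

/-- A classical solution of `-ΔU = F` away from the origin whose singularity is weaker than
`|x|^{2-dim}` is a distributional solution. -/
lemma neg_integral_mul_laplacian_eq [Nontrivial E] {U F φ : E → ℝ} (hU : ContDiffOn ℝ 2 U {0}ᶜ)
    (hUF : ∀ x, x ≠ 0 → Laplacian.laplacian U x = -F x) {s : ℝ}
    (hs : s + 2 < Module.finrank ℝ E)
    (hb : ∀ R : ℝ, ∃ C, ∀ x : E, x ≠ 0 → ‖x‖ ≤ R → |U x| ≤ C * ‖x‖ ^ (-s))
    (hF : LocallyIntegrable F) (hφ : ContDiff ℝ 2 φ) (hc : HasCompactSupport φ) :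
    -(∫ x, U x * Laplacian.laplacian φ x) = ∫ x, F x * φ x := by
  set η : ℕ → E → ℝ := fun n x => cutoff (((n : ℝ) + 1) • x) with hη
  have hη2 : ∀ n, ContDiff ℝ 2 (η n) := fun n => contDiff_cutoff.comp (contDiff_const_smul _)
  have hn0 : ∀ n : ℕ, (0 : ℝ) < (n : ℝ) + 1 := fun n => by positivity
  have key : ∀ n : ℕ, -(∫ x, U x * Laplacian.laplacian (fun y => φ y * η n y) x)
      = ∫ x, F x * φ x * η n x := by
    intro n
    rw [integral_mul_laplacian_mul_cutoff hU hφ hc (hn0 n), ← integral_neg]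
    refine integral_congr_ae ?_
    filter_upwards [ae_ne_zero] with x hx
    rw [hUF x hx]; ring
  obtain ⟨M, hM, hM'⟩ := exists_laplacian_mul_cutoff_bound hφ hc
  obtain ⟨R, hR⟩ := hc.isCompact.isBounded.exists_norm_le
  obtain ⟨C, hC⟩ := hb R
  have hUm := aestronglyMeasurable_of_continuousOn_compl hU.continuousOn
  -- Dominated convergence: `|U| ≤ |C| ‖x‖^{-s}` and the Laplacian is at most `M ‖x‖^{-2}`,
  -- uniformly in `n`; the product is integrable since `s + 2 < dim`.
  have lim1 : Tendsto (fun n : ℕ => ∫ x, U x * Laplacian.laplacian (fun y => φ y * η n y) x) atTop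
      (𝓝 (∫ x, U x * Laplacian.laplacian φ x)) := by
    refine tendsto_integral_of_dominated_convergence
      (fun x => |C| * M * (Iic R).indicator (fun r : ℝ => r ^ (-(s + 2))) ‖x‖)
      (fun n => hUm.mul (continuous_laplacian (hφ.mul (hη2 n))).aestronglyMeasurable)
      ((integrable_indicator_norm_rpow hs).const_mul _) (fun n => ?_) ?_
    · filter_upwards [ae_ne_zero] with x hx
      have hn : 0 < ‖x‖ := norm_pos_iff.2 hx
      rcases le_or_gt ‖x‖ R with hxR | hxR
      · rw [indicator_of_mem (mem_Iic.2 hxR), norm_mul, Real.norm_eq_abs, Real.norm_eq_abs]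
        have h1 : |Laplacian.laplacian (fun y => φ y * η n y) x| * ‖x‖ ^ 2 ≤ M :=
          hM' _ x (hn0 n)
        have h2 := hC x hx hxR
        have h3 : |Laplacian.laplacian (fun y => φ y * η n y) x| ≤ M * ‖x‖ ^ (-2 : ℝ) := by
          rw [Real.rpow_neg hn.le, ← div_eq_mul_inv, le_div_iff₀ (by positivity), Real.rpow_two]
          exact h1
        have h4 : |U x| ≤ |C| * ‖x‖ ^ (-s) := h2.trans (by gcongr; exact le_abs_self C)
        calc _ ≤ (|C| * ‖x‖ ^ (-s)) * (M * ‖x‖ ^ (-2 : ℝ)) := by gcongr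
          _ = |C| * M * (‖x‖ ^ (-s) * ‖x‖ ^ (-2 : ℝ)) := by ring
          _ = _ := by rw [← Real.rpow_add hn]; ring_nf
      · have hx' : x ∉ tsupport φ := fun h => by linarith [hR x h]
        have : (fun y => φ y * η n y) =ᶠ[𝓝 x] fun _ => 0 := by
          filter_upwards [(isClosed_tsupport φ).isOpen_compl.mem_nhds hx'] with y hy
          rw [image_eq_zero_of_notMem_tsupport hy, zero_mul]
        rw [laplacian_eq_zero_of_eventuallyEq this, mul_zero, norm_zero]
        rw [indicator_of_notMem (by simpa using hxR), mul_zero]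
    · filter_upwards [ae_ne_zero] with x hx
      refine tendsto_const_nhds.congr' ?_
      filter_upwards [tendsto_cutoff_smul hx] with n hn
      have : (fun y => φ y * η n y) =ᶠ[𝓝 x] φ := by
        filter_upwards [hn] with y hy
        simp only [hη]
        rw [hy, mul_one]
      rw [(InnerProductSpace.laplacian_congr_nhds this).eq_of_nhds]
  have hFφ : Integrable (fun x => F x * φ x) := by
    have := hF.integrable_smul_left_of_hasCompactSupport hφ.continuous hc
    refine this.congr (Eventually.of_forall fun x => ?_)
    simp only [smul_eq_mul]; ring
  have lim2 : Tendsto (fun n : ℕ => ∫ x, F x * φ x * η n x) atTop (𝓝 (∫ x, F x * φ x)) := by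
    refine tendsto_integral_of_dominated_convergence (fun x => ‖F x * φ x‖)
      (fun n => hFφ.aestronglyMeasurable.mul (hη2 n).continuous.aestronglyMeasurable)
      hFφ.norm (fun n => Eventually.of_forall fun x => ?_) ?_
    · rw [norm_mul]
      exact mul_le_of_le_one_right (norm_nonneg _) (abs_cutoff_le _)
    · filter_upwards [ae_ne_zero] with x hx
      refine tendsto_const_nhds.congr' ?_
      filter_upwards [tendsto_cutoff_smul hx] with n hn
      simp only [hη]
      rw [hn.eq_of_nhds, mul_one]
  refine tendsto_nhds_unique lim1.neg (lim2.congr fun n => (key n).symm)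

end Cutoff

/-! ### The radial extension -/

section RadialSolution

variable {N : ℕ} {α : ℝ} {u : ℝ → ℝ}

lemma IsSolution.contDiffOn_radial (hu : IsSolution N α u) :
    ContDiffOn ℝ 2 (radial N u) {0}ᶜ := by
  intro x hx
  have hx : x ≠ 0 := hx
  have h1 : ContDiffAt ℝ 2 u ‖x‖ := hu.1.contDiffAt (Ioi_mem_nhds (norm_pos_iff.2 hx))
  exact (h1.comp x (contDiffAt_norm ℝ hx)).contDiffWithinAt

lemma IsSolution.radial_distributional (hN : 3 ≤ N) (hα₁ : 2 / ((N : ℝ) - 2) < α)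
    (hα₂ : α < 4 / ((N : ℝ) - 2)) (hu : IsSolution N α u) :
    (∀ K : Set (EuclideanSpace ℝ (Fin N)), IsCompact K →
        MemLp (radial N u) (ENNReal.ofReal (α + 1)) (volume.restrict K)) ∧
      IsDistributionalSolution N α (radial N u) := by
  obtain ⟨hα, hp, hq, hqp⟩ := exponents_pos hN hα₁ hα₂
  have hfin : Module.finrank ℝ (EuclideanSpace ℝ (Fin N)) = N := finrank_euclideanSpace_fin
  have : Nontrivial (EuclideanSpace ℝ (Fin N)) :=
    Module.nontrivial_of_finrank_pos (R := ℝ) (by rw [hfin]; omega)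
  -- This is `q > 0` once more.
  have hsN : 2 / α + 2 < Module.finrank ℝ (EuclideanSpace ℝ (Fin N)) := by
    rw [hfin]; unfold decayExp at hq; linarith
  have hC2 := hu.contDiffOn_radial
  have hb : ∀ R : ℝ, ∃ C, 0 ≤ C ∧ ∀ x : EuclideanSpace ℝ (Fin N), x ≠ 0 → ‖x‖ ≤ R →
      |radial N u x| ≤ C * ‖x‖ ^ (-(2 / α)) := fun R => by
    obtain ⟨C, hC, h⟩ := hu.exists_abs_le_rpow_near_zero hN hα₁ hα₂ R
    exact ⟨C, hC, fun x hx hxR => h _ (norm_pos_iff.2 hx) hxR⟩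
  -- The exponent is `(2/α)(α + 1) = 2/α + 2`.
  have hb' : ∀ R : ℝ, ∃ C, ∀ x : EuclideanSpace ℝ (Fin N), x ≠ 0 → ‖x‖ ≤ R →
      |radial N u x| ^ (α + 1) ≤ C * ‖x‖ ^ (-(2 / α + 2)) := fun R => by
    obtain ⟨C, hC, h⟩ := hb R
    refine ⟨C ^ (α + 1), fun x hx hxR => ?_⟩
    have hn : 0 < ‖x‖ := norm_pos_iff.2 hx
    calc |radial N u x| ^ (α + 1) ≤ (C * ‖x‖ ^ (-(2 / α))) ^ (α + 1) := by
          gcongr; exact h x hx hxR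
      _ = _ := by
          rw [Real.mul_rpow hC (by positivity), ← Real.rpow_mul hn.le]
          congr 2; field_simp; ring
  have hpow : ContinuousOn (fun x => |radial N u x| ^ (α + 1)) {0}ᶜ :=
    hC2.continuousOn.abs.rpow_const fun _ _ => Or.inr (by linarith)
  have hF : ContinuousOn (fun x => |radial N u x| ^ α * radial N u x) {0}ᶜ :=
    (hC2.continuousOn.abs.rpow_const fun _ _ => Or.inr hα.le).mul hC2.continuousOn
  have hUint : LocallyIntegrable (radial N u) volume :=
    (locallyIntegrable_iff).2 fun K hK =>
      integrableOn_of_abs_le_norm_rpow hC2.continuousOn (s := 2 / α) (by linarith)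
        (fun R => by obtain ⟨C, -, h⟩ := hb R; exact ⟨C, h⟩) hK
  have hFint : LocallyIntegrable (fun x => |radial N u x| ^ α * radial N u x) volume :=
    (locallyIntegrable_iff).2 fun K hK =>
      integrableOn_of_abs_le_norm_rpow hF hsN (fun R => by
        obtain ⟨C, h⟩ := hb' R
        refine ⟨C, fun x hx hxR => ?_⟩
        rw [abs_mul, abs_of_nonneg (Real.rpow_nonneg (abs_nonneg _) _),
          ← Real.rpow_add_one' (abs_nonneg _) (by linarith)]
        exact h x hx hxR) hK
  have two_le : (2 : WithTop ℕ∞) ≤ ((⊤ : ℕ∞) : WithTop ℕ∞) :=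
    WithTop.coe_le_coe.2 (le_top (a := (2 : ℕ∞)))
  refine ⟨fun K hK => ?_, hUint, hFint, fun φ hφ hc => ?_⟩
  · have h1 : IntegrableOn (fun x => |radial N u x| ^ (α + 1)) K :=
      integrableOn_of_abs_le_norm_rpow hpow hsN (fun R => by
        obtain ⟨C, h⟩ := hb' R
        refine ⟨C, fun x hx hxR => ?_⟩
        rw [abs_of_nonneg (Real.rpow_nonneg (abs_nonneg _) _)]
        exact h x hx hxR) hK
    rw [← integrable_norm_rpow_iff
      (aestronglyMeasurable_of_continuousOn_compl hC2.continuousOn).restrict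
      (by simp; linarith) ENNReal.ofReal_ne_top, ENNReal.toReal_ofReal (by linarith)]
    exact h1
  · refine neg_integral_mul_laplacian_eq hC2 (fun x hx => ?_) hsN
      (fun R => by obtain ⟨C, -, h⟩ := hb R; exact ⟨C, h⟩) hFint (hφ.of_le two_le) hc
    have h1 := laplacian_comp_norm (h := u) (x := x) hx (fun r hr => hu.hasDerivAt hr)
      (fun r hr => hu.hasDerivAt_deriv hr) (hC2.contDiffAt (isOpen_compl_singleton.mem_nhds hx))
    have h2 := hu.2 _ (norm_pos_iff.2 hx)
    rw [hfin] at h1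
    rw [show Laplacian.laplacian (radial N u) x
      = Laplacian.laplacian (fun y : EuclideanSpace ℝ (Fin N) => u ‖y‖) x from rfl, h1]
    simp only [radial]
    linarith

end RadialSolution

end RadialStationary

/-! ### Assembly of the proposition from the trichotomy -/

open RadialStationary
theorem proposition6p1 (N : ℕ) (hN : 3 ≤ N) (α : ℝ)
    (hα₁ : 2 / ((N : ℝ) - 2) < α) (hα₂ : α < 4 / ((N : ℝ) - 2))
    (u : ℝ → ℝ) (hu : IsSolution N α u) (hu₀ : ∃ r : ℝ, 0 < r ∧ u r ≠ 0) :
    -- (i) decay at infinity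
    (∃ C : ℝ, ∀ r : ℝ, 1 < r → |u r| ≤ C * r ^ (-((N : ℝ) - 2 - 2 / α))) ∧
    -- (i) behavior at the origin
    ((∃ l : ℝ, Tendsto u (𝓝[>] 0) (𝓝 l) ∧ Tendsto (deriv u) (𝓝[>] 0) (𝓝 0)) ∨
      (∃ σ : ℝ, (σ = 1 ∨ σ = -1) ∧
        Tendsto (fun r : ℝ => r ^ (2 / α) * u r) (𝓝[>] 0) (𝓝 (σ * beta N α ^ (1 / α))) ∧
        Tendsto (fun r : ℝ => r ^ (2 / α + 1) * deriv u r) (𝓝[>] 0)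
          (𝓝 (-σ * (2 / α * beta N α ^ (1 / α)))))) ∧
    -- (ii) the three kinds of solutions
    (IsRegularSolution u ∨ IsConstantSignSingular N α u ∨ (IsSingular u ∧ IsSignChanging u)) ∧
    (IsRegularSolution u → OscillatesAtInfinity u) ∧
    (IsSingular u ∧ IsSignChanging u →
      (Tendsto (fun r : ℝ => r ^ (2 / α) * u r) (𝓝[>] 0) (𝓝 (beta N α ^ (1 / α))) ∨
        Tendsto (fun r : ℝ => r ^ (2 / α) * u r) (𝓝[>] 0) (𝓝 (-(beta N α ^ (1 / α))))) ∧
      OscillatesAtInfinity u) ∧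
    -- (iii) characterization of the singular sign-changing solutions
    ((IsSingular u ∧ IsSignChanging u) ↔ ∃ r₀ : ℝ, 0 < r₀ ∧ energy N α u r₀ = 0) ∧
    -- (iv) the associated function on `ℝ^N`
    (ContDiffOn ℝ 2 (radial N u) {0}ᶜ ∧
      (∀ K : Set (EuclideanSpace ℝ (Fin N)), IsCompact K →
        MemLp (radial N u) (ENNReal.ofReal (α + 1)) (volume.restrict K)) ∧
      IsDistributionalSolution N α (radial N u)) := by
  have hdist := And.intro hu.contDiffOn_radial (hu.radial_distributional hN hα₁ hα₂)
  refine ⟨hu.exists_abs_le_rpow hN hα₁ hα₂, ?_⟩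
  rcases hu.classification hN hα₁ hα₂ hu₀ with ⟨hreg, hosc, hns, hlim, hE⟩ |
    ⟨hnr, hsing, hlim, hcase⟩
  · exact ⟨Or.inl hlim, Or.inl hreg, fun _ => hosc, fun h => absurd h.1 hns,
      ⟨fun h => absurd h.1 hns, fun h => absurd h hE⟩, hdist⟩
  · refine ⟨Or.inr hlim, ?_, fun h => absurd h hnr, fun h => ⟨?_, ?_⟩, ?_, hdist⟩
    · rcases hcase with ⟨hsc, -, -⟩ | ⟨-, hcs, -⟩
      · exact Or.inr (Or.inr ⟨hsing, hsc⟩)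
      · exact Or.inr (Or.inl hcs)
    · obtain ⟨σ, hσ, h1, -⟩ := hlim
      rcases hσ with rfl | rfl
      · exact Or.inl (by simpa using h1)
      · exact Or.inr (by simpa using h1)
    · rcases hcase with ⟨-, hosc, -⟩ | ⟨hnsc, -, -⟩
      · exact hosc
      · exact absurd h.2 hnsc
    · rcases hcase with ⟨hsc, -, hE⟩ | ⟨hnsc, -, hE⟩
      · exact ⟨fun _ => hE, fun _ => ⟨hsing, hsc⟩⟩
      · exact ⟨fun h => absurd h.2 hnsc, fun h => absurd h hE⟩
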